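/- Let $n\in\mathbb N_0$. Let $\mathcal K_1(\mathbb R^n)$ be the space of all $\varphi\in C^\infty(\mathbb R^n)$ such that $\nu_k(\varphi)=\sup_{t\in\mathbb R^n,\,|\alpha|\le k}e^{k|t|}|\varphi^{(\alpha)}(t)|<\infty$ for every $k\in\mathbb N_0$, with the topology given by the norms $\nu_k$, and let $\mathcal K_1'(\mathbb R^n)$ be its strong dual. Let $\Pi_k=\mathbb R^n+i[-k,k]^n$, and let $\mathcal K_1(\mathbb R^n)\widehat\otimes\,\mathcal U(\mathbb C^n)$ be the space of all functions $\Phi(x,z)$ on $\mathbb R^n\times\mathbb C^n$, smooth in $x$ and entire in $z$, such that $$\rho_k(\Phi)=\sup_{x\in\mathbb R^n,\;z\in\Pi_k,\;|\alpha|\le k}e^{k|x|}(1+|z|^2)^{k/2}\left|\partial_x^\alpha\Phi(x,z)\right|<\infty\qquad(k\in\mathbb N_0),$$ with the topology given by the norms $\rho_k$; its strong dual is denoted by $\mathcal K_1'(\mathbb R^n)\widehat\otimes\,\mathcal U'(\mathbb C^n)$. For $f\in\mathcal K_1'(\mathbb R^n)$, $\psi\in\mathcal K_1(\mathbb R^n)$,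 $x\in\mathbb R^n$ and $z\in\mathbb C^n$ put $$V_\psi f(x,z)=\big\langle f(t),\,\overline{\psi(t-x)}\,e^{-2\pi i z\cdot t}\big\rangle_t ,$$ and for $\varphi\in\mathcal K_1(\mathbb R^n)$ put $V_\psi\varphi(x,z)=\int_{\mathbb R^n}\varphi(t)\overline{\psi(t-x)}e^{-2\pi i z\cdot t}\,dt$. Let $(\gamma,\psi)_{L^2}=\int_{\mathbb R^n}\gamma(t)\overline{\psi(t)}\,dt$. **Theorem.** (a) For all $f\in\mathcal K_1'(\mathbb R^n)$ and $\psi\in\mathcal K_1(\mathbb R^n)$ the absolutely convergent integrals $$\langle V_\psi f,\Phi\rangle=\iint_{\mathbb R^{2n}}V_\psi f(x,\xi)\,\Phi(x,\xi)\,dx\,d\xi,\qquad \Phi\in\mathcal K_1(\mathbb R^n)\widehat\otimes\,\mathcal U(\mathbb C^n),$$ define an element $V_\psi f$ of $\mathcal K_1'(\mathbb R^n)\widehat\otimes\,\mathcal U'(\mathbb C^n)$, and the sesquilinear map $$V:\mathcal K_1'(\mathbb R^n)\times\mathcal K_1(\mathbb R^n)\to\mathcal K_1'(\mathbb R^n)\widehat\otimes\,\mathcal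 U'(\mathbb C^n),\qquad (f,\psi)\mapsto V_\psi f,$$ is hypocontinuous. (b) For all $F\in\mathcal K_1'(\mathbb R^n)\widehat\otimes\,\mathcal U'(\mathbb C^n)$ and $\psi\in\mathcal K_1(\mathbb R^n)$ the formula $$\langle V_\psi^*F,\varphi\rangle=\big\langle F,\overline{V_\psi\overline\varphi}\big\rangle,\qquad\varphi\in\mathcal K_1(\mathbb R^n),$$ in which $\overline{V_\psi\overline\varphi}$ stands for the element $(x,z)\mapsto\overline{V_\psi\overline\varphi(x,\overline z)}$ of $\mathcal K_1(\mathbb R^n)\widehat\otimes\,\mathcal U(\mathbb C^n)$, defines an element $V_\psi^*F$ of $\mathcal K_1'(\mathbb R^n)$, and the bilinear map $$V^*:\big(\mathcal K_1'(\mathbb R^n)\widehat\otimes\,\mathcal U'(\mathbb C^n)\big)\times\mathcal K_1(\mathbb R^n)\to\mathcal K_1'(\mathbb R^n),\qquad(F,\psi)\mapsto V_\psi^*F,$$ is hypocontinuous. (c) Let $\psi\in\mathcal K_1(\mathbb R^n)\setminus\{0\}$ and let $\gamma\in\mathcal K_1(\mathbb R^n)$ be a synthesis window for $\psi$, that is,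 $(\gamma,\psi)_{L^2}\ne0$. Then $$\frac1{(\gamma,\psi)_{L^2}}\,V_\gamma^*V_\psi=\mathrm{id}_{\mathcal K_1'(\mathbb R^n)},$$ and, for all $f\in\mathcal K_1'(\mathbb R^n)$, $\varphi\in\mathcal K_1(\mathbb R^n)$ and $\eta\in\mathbb R^n$, $$\langle f,\varphi\rangle=\frac1{(\gamma,\psi)_{L^2}}\iint_{\mathbb R^{2n}}V_\psi f(x,\xi+i\eta)\,V_{\overline\gamma}\varphi(x,-\xi-i\eta)\,dx\,d\xi ,$$ the integral being absolutely convergent. Here a sesquilinear or bilinear map $\beta:E\times F\to G$ is hypocontinuous if for every bounded $B\subset E$ the maps $\beta(x,\cdot)$, $x\in B$, are equicontinuous, and for every bounded $B\subset F$ the maps $\beta(\cdot,y)$, $y\in B$, are equicontinuous. -/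

import Mathlib

open MeasureTheory Topology
open scoped ContDiff ComplexConjugate

noncomputable section

namespace ExpSTFT

/-- The space `ℝⁿ` with its Euclidean norm. -/
abbrev RSp (n : ℕ) : Type := EuclideanSpace ℝ (Fin n)

/-- The space `ℂⁿ` with its Hermitian norm. -/
abbrev CSp (n : ℕ) : Type := EuclideanSpace ℂ (Fin n)

/-- The point `ξ + i η` of `ℂⁿ`. -/
def cpt {n : ℕ} (ξ η : RSp n) : CSp n :=
  WithLp.toLp 2 fun i => (ξ i : ℂ) + (η i : ℂ) * Complex.I

/-- The coordinatewise complex conjugate of a point of `ℂⁿ`. -/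
def conjPt {n : ℕ} (z : CSp n) : CSp n := WithLp.toLp 2 fun i => conj (z i)

/-- The bilinear product `z · t = z₁ t₁ + … + zₙ tₙ` of `z ∈ ℂⁿ` and `t ∈ ℝⁿ`. -/
def cdot {n : ℕ} (z : CSp n) (t : RSp n) : ℂ := ∑ i, z i * (t i : ℂ)

/-- The tube `Π_k = ℝⁿ + i [-k, k]ⁿ`. -/
def tube (n k : ℕ) : Set (CSp n) := {z | ∀ i, |(z i).im| ≤ k}

lemma ciSup_add_bound {ι : Type*} [Nonempty ι] {f g h : ι → ℝ} (hle : ∀ i, f i ≤ g i + h i)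
    (hg : BddAbove (Set.range g)) (hh : BddAbove (Set.range h)) :
    ⨆ i, f i ≤ (⨆ i, g i) + ⨆ i, h i :=
  ciSup_le fun i => (hle i).trans (add_le_add (le_ciSup hg i) (le_ciSup hh i))

/-! ### The test function space `𝒦₁(ℝⁿ)` -/

/-- The weighted derivative `e^{k|t|} |φ^{(j)}(t)|`, where `φ^{(j)}(t)` is the full derivative of
order `j`, measured in the operator norm (which is equivalent to the largest modulus of the
partial derivatives of order `j`). -/
def wder {n : ℕ} (k : ℕ) (φ : RSp n → ℂ) (j : ℕ) (t : RSp n) : ℝ :=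
  Real.exp (k * ‖t‖) * ‖iteratedFDeriv ℝ j φ t‖

lemma wder_add {n : ℕ} (k : ℕ) {φ χ : RSp n → ℂ} (hφ : ContDiff ℝ ∞ φ) (hχ : ContDiff ℝ ∞ χ)
    (j : ℕ) (t : RSp n) : wder k (φ + χ) j t ≤ wder k φ j t + wder k χ j t := by
  unfold wder
  rw [iteratedFDeriv_add_apply (hφ.of_le (by exact_mod_cast le_top)).contDiffAt
    (hχ.of_le (by exact_mod_cast le_top)).contDiffAt, ← mul_add]
  gcongr
  exact norm_add_le _ _

lemma wder_smul {n : ℕ} (k : ℕ) (c : ℂ) {φ : RSp n → ℂ} (hφ : ContDiff ℝ ∞ φ)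
    (j : ℕ) (t : RSp n) : wder k (c • φ) j t = ‖c‖ * wder k φ j t := by
  unfold wder
  rw [iteratedFDeriv_const_smul_apply (hφ.of_le (by exact_mod_cast le_top)).contDiffAt, norm_smul]
  ring

/-- The smooth functions on `ℝⁿ` all of whose norms `ν_k` are finite. -/
def k1Submodule (n : ℕ) : Submodule ℂ (RSp n → ℂ) where
  carrier := {φ | ContDiff ℝ ∞ φ ∧ ∀ k : ℕ, ∃ C : ℝ, ∀ j ≤ k, ∀ t, wder k φ j t ≤ C}
  zero_mem' := ⟨contDiff_const, fun k => ⟨0, fun j _ t => by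
    have := wder_smul k 0 (φ := (0 : RSp n → ℂ)) contDiff_const j t
    simpa using this.le⟩⟩
  add_mem' := by
    rintro φ χ ⟨hφ, bφ⟩ ⟨hχ, bχ⟩
    refine ⟨hφ.add hχ, fun k => ?_⟩
    obtain ⟨C, hC⟩ := bφ k
    obtain ⟨D, hD⟩ := bχ k
    exact ⟨C + D, fun j hj t => (wder_add k hφ hχ j t).trans (add_le_add (hC j hj t) (hD j hj t))⟩
  smul_mem' := by
    rintro c φ ⟨hφ, bφ⟩
    refine ⟨hφ.const_smul c, fun k => ?_⟩
    obtain ⟨C, hC⟩ := bφ k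
    refine ⟨‖c‖ * C, fun j hj t => ?_⟩
    rw [wder_smul k c hφ]
    exact mul_le_mul_of_nonneg_left (hC j hj t) (norm_nonneg c)

/-- The space `𝒦₁(ℝⁿ)` of exponentially rapidly decreasing smooth functions. -/
def K1 (n : ℕ) : Type := k1Submodule n

instance (n : ℕ) : AddCommGroup (K1 n) := inferInstanceAs (AddCommGroup (k1Submodule n))

instance (n : ℕ) : Module ℂ (K1 n) := inferInstanceAs (Module ℂ (k1Submodule n))

instance (n : ℕ) : FunLike (K1 n) (RSp n) ℂ where
  coe φ := φ.1
  coe_injective _ _ h := Subtype.ext h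

namespace K1

lemma bdd {n : ℕ} (φ : K1 n) (k : ℕ) :
    BddAbove (Set.range fun p : Fin (k + 1) × RSp n => wder k φ p.1 p.2) := by
  obtain ⟨C, hC⟩ := φ.2.2 k
  exact ⟨C, by rintro _ ⟨p, rfl⟩; exact hC p.1 (Nat.lt_succ_iff.mp p.1.2) p.2⟩

/-- The norm `ν_k(φ) = sup e^{k|t|} |φ^{(j)}(t)|` over `t ∈ ℝⁿ` and `j ≤ k`. -/
def nu (n k : ℕ) : Seminorm ℂ (K1 n) :=
  Seminorm.ofSMulLE (fun φ => ⨆ p : Fin (k + 1) × RSp n, wder k φ p.1 p.2)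
    (by
      have : ∀ p : Fin (k + 1) × RSp n, wder k ((0 : K1 n) : RSp n → ℂ) p.1 p.2 = 0 := fun p => by
        have := wder_smul k 0 (φ := (0 : RSp n → ℂ)) contDiff_const p.1 p.2
        simp only [zero_smul, norm_zero, zero_mul] at this
        exact this
      simp only [this, ciSup_const])
    (fun φ χ => ciSup_add_bound (fun p => wder_add k φ.2.1 χ.2.1 p.1 p.2) (φ.bdd k) (χ.bdd k))
    (fun c φ => ciSup_le fun p => (wder_smul k c φ.2.1 p.1 p.2).le.trans
      (mul_le_mul_of_nonneg_left (le_ciSup (φ.bdd k) p) (norm_nonneg c)))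

/-- The family of norms `ν_k`, `k ∈ ℕ`. -/
def nuFamily (n : ℕ) : SeminormFamily ℂ (K1 n) ℕ := fun k => nu n k

/-- `𝒦₁(ℝⁿ)` carries the locally convex topology given by the norms `ν_k`. -/
instance (n : ℕ) : TopologicalSpace (K1 n) := (nuFamily n).moduleFilterBasis.topology

lemma withSeminorms (n : ℕ) : WithSeminorms (nuFamily n) := ⟨rfl⟩

instance (n : ℕ) : IsTopologicalAddGroup (K1 n) :=
  (nuFamily n).addGroupFilterBasis.isTopologicalAddGroup

instance (n : ℕ) : ContinuousSMul ℂ (K1 n) := (nuFamily n).moduleFilterBasis.continuousSMul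

end K1

/-- The space `𝒦₁'(ℝⁿ)` of distributions of exponential type: the dual of `𝒦₁(ℝⁿ)` with the strong
topology (uniform convergence on bounded sets). -/
abbrev K1Dual (n : ℕ) : Type := K1 n →L[ℂ] ℂ

/-! ### The test function space `𝒦₁(ℝⁿ) ⊗̂ 𝒰(ℂⁿ)` -/

/-- The weighted derivative `e^{k|x|} (1 + |z|²)^{k/2} |∂ₓ^{(j)} Φ(x, z)|`. -/
def wderU {n : ℕ} (k : ℕ) (Φ : RSp n → CSp n → ℂ) (j : ℕ) (x : RSp n) (z : CSp n) : ℝ :=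
  (1 + ‖z‖ ^ 2) ^ ((k : ℝ) / 2) * wder k (fun y => Φ y z) j x

/-- The functions `Φ(x, z)` on `ℝⁿ × ℂⁿ`, smooth in `x` and entire in `z`, all of whose norms `ρ_k`
are finite. (Finiteness of these norms makes such a `Φ` jointly smooth, and its `x`-derivatives
entire in `z`.) -/
def kuSubmodule (n : ℕ) : Submodule ℂ (RSp n → CSp n → ℂ) where
  carrier := {Φ | (∀ z, ContDiff ℝ ∞ fun x => Φ x z) ∧ (∀ x, Differentiable ℂ (Φ x)) ∧
    ∀ k : ℕ, ∃ C : ℝ, ∀ j ≤ k, ∀ x, ∀ z ∈ tube n k, wderU k Φ j x z ≤ C}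
  zero_mem' := ⟨fun _ => contDiff_const, fun _ => differentiable_const _, fun k => ⟨0,
    fun j _ x z _ => by
      have := wder_smul k 0 (φ := (0 : RSp n → ℂ)) contDiff_const j x
      simp only [zero_smul, norm_zero, zero_mul] at this
      exact (mul_eq_zero_of_right _ this).le⟩⟩
  add_mem' := by
    rintro Φ Ψ ⟨hΦ, eΦ, bΦ⟩ ⟨hΨ, eΨ, bΨ⟩
    refine ⟨fun z => (hΦ z).add (hΨ z), fun x => (eΦ x).add (eΨ x), fun k => ?_⟩
    obtain ⟨C, hC⟩ := bΦ k
    obtain ⟨D, hD⟩ := bΨ k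
    refine ⟨C + D, fun j hj x z hz => le_trans ?_ (add_le_add (hC j hj x z hz) (hD j hj x z hz))⟩
    unfold wderU
    rw [← mul_add]
    exact mul_le_mul_of_nonneg_left (wder_add k (hΦ z) (hΨ z) j x) (by positivity)
  smul_mem' := by
    rintro c Φ ⟨hΦ, eΦ, bΦ⟩
    refine ⟨fun z => (hΦ z).const_smul c, fun x => (eΦ x).const_smul c, fun k => ?_⟩
    obtain ⟨C, hC⟩ := bΦ k
    refine ⟨‖c‖ * C, fun j hj x z hz => le_trans ?_
      (mul_le_mul_of_nonneg_left (hC j hj x z hz) (norm_nonneg c))⟩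
    have := wder_smul k c (hΦ z) j x
    exact ((congrArg _ this).trans (mul_left_comm _ _ _)).le

/-- The space `𝒦₁(ℝⁿ) ⊗̂ 𝒰(ℂⁿ)`, realized as a space of functions on `ℝⁿ × ℂⁿ`. -/
def KU (n : ℕ) : Type := kuSubmodule n

instance (n : ℕ) : AddCommGroup (KU n) := inferInstanceAs (AddCommGroup (kuSubmodule n))

instance (n : ℕ) : Module ℂ (KU n) := inferInstanceAs (Module ℂ (kuSubmodule n))

instance (n : ℕ) : FunLike (KU n) (RSp n) (CSp n → ℂ) where
  coe Φ := Φ.1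
  coe_injective _ _ h := Subtype.ext h

namespace KU

instance (n k : ℕ) : Nonempty (tube n k) := ⟨⟨0, fun i => by simp⟩⟩

lemma bdd {n : ℕ} (Φ : KU n) (k : ℕ) : BddAbove (Set.range
    fun p : Fin (k + 1) × RSp n × tube n k => wderU k Φ p.1 p.2.1 p.2.2) := by
  obtain ⟨C, hC⟩ := Φ.2.2.2 k
  exact ⟨C, by rintro _ ⟨p, rfl⟩; exact hC p.1 (Nat.lt_succ_iff.mp p.1.2) p.2.1 _ p.2.2.2⟩

lemma wderU_add {n : ℕ} (k : ℕ) (Φ Ψ : KU n) (j : ℕ) (x : RSp n) (z : CSp n) :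
    wderU k (Φ + Ψ : KU n) j x z ≤ wderU k Φ j x z + wderU k Ψ j x z := by
  unfold wderU
  rw [← mul_add]
  exact mul_le_mul_of_nonneg_left (wder_add k (Φ.2.1 z) (Ψ.2.1 z) j x) (by positivity)

lemma wderU_smul {n : ℕ} (k : ℕ) (c : ℂ) (Φ : KU n) (j : ℕ) (x : RSp n) (z : CSp n) :
    wderU k (c • Φ : KU n) j x z = ‖c‖ * wderU k Φ j x z :=
  (congrArg _ (wder_smul k c (Φ.2.1 z) j x)).trans (mul_left_comm _ _ _)

/-- The norm `ρ_k(Φ) = sup e^{k|x|} (1 + |z|²)^{k/2} |∂ₓ^{(j)} Φ(x, z)|` over `x ∈ ℝⁿ`, `z ∈ Π_k` and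
`j ≤ k`. -/
def rho (n k : ℕ) : Seminorm ℂ (KU n) :=
  Seminorm.ofSMulLE (fun Φ => ⨆ p : Fin (k + 1) × RSp n × tube n k, wderU k Φ p.1 p.2.1 p.2.2)
    (by
      have : ∀ p : Fin (k + 1) × RSp n × tube n k,
          wderU k ((0 : KU n) : RSp n → CSp n → ℂ) p.1 p.2.1 p.2.2 = 0 := fun p => by
        have := wderU_smul k 0 (0 : KU n) p.1 p.2.1 p.2.2
        rwa [zero_smul, norm_zero, zero_mul] at this
      simp only [this, ciSup_const])
    (fun Φ Ψ => ciSup_add_bound (fun p => wderU_add k Φ Ψ p.1 p.2.1 p.2.2) (Φ.bdd k) (Ψ.bdd k))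
    (fun c Φ => ciSup_le fun p => (wderU_smul k c Φ p.1 p.2.1 p.2.2).le.trans
      (mul_le_mul_of_nonneg_left (le_ciSup (Φ.bdd k) p) (norm_nonneg c)))

/-- The family of norms `ρ_k`, `k ∈ ℕ`. -/
def rhoFamily (n : ℕ) : SeminormFamily ℂ (KU n) ℕ := fun k => rho n k

/-- `𝒦₁(ℝⁿ) ⊗̂ 𝒰(ℂⁿ)` carries the locally convex topology given by the norms `ρ_k`. -/
instance (n : ℕ) : TopologicalSpace (KU n) := (rhoFamily n).moduleFilterBasis.topology

lemma withSeminorms (n : ℕ) : WithSeminorms (rhoFamily n) := ⟨rfl⟩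

instance (n : ℕ) : IsTopologicalAddGroup (KU n) :=
  (rhoFamily n).addGroupFilterBasis.isTopologicalAddGroup

instance (n : ℕ) : ContinuousSMul ℂ (KU n) := (rhoFamily n).moduleFilterBasis.continuousSMul

end KU

/-- The space `𝒦₁'(ℝⁿ) ⊗̂ 𝒰'(ℂⁿ) = (𝒦₁(ℝⁿ) ⊗̂ 𝒰(ℂⁿ))'`, with the strong dual topology. -/
abbrev KUDual (n : ℕ) : Type := KU n →L[ℂ] ℂ

/-! ### The short-time Fourier transform -/

/-- The exponential `t ↦ e^{-2π i z · t}`. -/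
def cexpo {n : ℕ} (z : CSp n) (t : RSp n) : ℂ :=
  Complex.exp (-2 * Real.pi * Complex.I * cdot z t)

/-- The real-linear form `t ↦ -2π i z · t`. -/
def expoForm {n : ℕ} (z : CSp n) : RSp n →L[ℝ] ℂ :=
  ∑ i, (EuclideanSpace.proj i : RSp n →L[ℝ] ℝ).smulRight
    (-2 * Real.pi * Complex.I * z i)

lemma cexpo_eq {n : ℕ} (z : CSp n) : cexpo z = fun t => Complex.exp (expoForm z t) := by
  funext t
  simp only [cexpo, cdot, expoForm, Finset.mul_sum, sum_apply,
    ContinuousLinearMap.smulRight_apply, PiLp.proj_apply, Complex.real_smul]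
  congr 1
  exact Finset.sum_congr rfl fun i _ => by ring

lemma contDiff_cexpo {n : ℕ} (z : CSp n) : ContDiff ℝ ∞ (cexpo z) := by
  rw [cexpo_eq]
  exact (expoForm z).contDiff.cexp

lemma norm_iteratedFDeriv_cexpo {n : ℕ} (z : CSp n) (m : ℕ) (t : RSp n) :
    ‖iteratedFDeriv ℝ m (cexpo z) t‖ ≤ ‖expoForm z‖ ^ m * Real.exp (‖expoForm z‖ * ‖t‖) := by
  induction m generalizing t with
  | zero =>
    rw [norm_iteratedFDeriv_zero, cexpo_eq, Complex.norm_exp, pow_zero, one_mul]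
    exact Real.exp_le_exp.mpr (((Complex.re_le_norm _).trans ((expoForm z).le_opNorm t)))
  | succ m ih =>
    have hd : fderiv ℝ (cexpo z) =
        (ContinuousLinearMap.toSpanSingleton ℂ (expoForm z)).restrictScalars ℝ ∘ cexpo z := by
      funext s
      rw [cexpo_eq]
      simpa using ((expoForm z).hasFDerivAt (x := s)).cexp.fderiv
    rw [← norm_iteratedFDeriv_fderiv, hd]
    refine (ContinuousLinearMap.norm_iteratedFDeriv_comp_left _ (N := ∞)
      (contDiff_cexpo z).contDiffAt (by exact_mod_cast le_top)).trans ?_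
    rw [ContinuousLinearMap.norm_restrictScalars, ContinuousLinearMap.norm_toSpanSingleton, pow_succ']
    rw [mul_assoc]
    exact mul_le_mul_of_nonneg_left (ih t) (norm_nonneg _)

lemma atom_mem {n : ℕ} (ψ : K1 n) (x : RSp n) (z : CSp n) :
    (fun t => conj (ψ (t - x)) * cexpo z t) ∈ k1Submodule n := by
  have hs : ContDiff ℝ ∞ (fun t => conj (ψ (t - x))) :=
    Complex.conjCLE.contDiff.comp (ψ.2.1.comp (contDiff_id.sub contDiff_const))
  refine ⟨hs.mul (contDiff_cexpo z), fun k => ?_⟩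
  set L := ‖expoForm z‖ with hL
  obtain ⟨K, hK⟩ := exists_nat_ge ((k : ℝ) + L)
  have hkK : k ≤ K := by
    have : (k : ℝ) ≤ K := by linarith [norm_nonneg (expoForm z)]
    exact_mod_cast this
  obtain ⟨C, hC⟩ := ψ.2.2 K
  refine ⟨∑ j ∈ Finset.range (k + 1), ∑ i ∈ Finset.range (j + 1),
    (j.choose i : ℝ) * (Real.exp (K * ‖x‖) * C * L ^ (j - i)), fun j hj t => ?_⟩
  have hC0 : 0 ≤ C := le_trans (by unfold wder; positivity) (hC 0 (Nat.zero_le _) 0)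
  have key : wder k (fun t => conj (ψ (t - x)) * cexpo z t) j t ≤
      ∑ i ∈ Finset.range (j + 1),
        (j.choose i : ℝ) * (Real.exp (K * ‖x‖) * C * L ^ (j - i)) := by
    unfold wder
    refine (mul_le_mul_of_nonneg_left (norm_iteratedFDeriv_mul_le hs (contDiff_cexpo z) t
      (by exact_mod_cast le_top)) (Real.exp_pos _).le).trans ?_
    rw [Finset.mul_sum]
    refine Finset.sum_le_sum fun i hi => ?_
    have hi' : i ≤ K := by have := Finset.mem_range.mp hi; omega
    have h1 : ‖iteratedFDeriv ℝ i (fun t => conj (ψ (t - x))) t‖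
        = ‖iteratedFDeriv ℝ i ψ (t - x)‖ := by
      have := Complex.conjLIE.norm_iteratedFDeriv_comp_left (𝕜 := ℝ) (fun t => ψ (t - x)) t i
      rw [iteratedFDeriv_comp_sub] at this
      exact this
    have h2 := hC i hi' (t - x)
    have h3 := norm_iteratedFDeriv_cexpo z (j - i) t
    rw [← hL] at h3
    unfold wder at h2
    have h4 : Real.exp (k * ‖t‖) * Real.exp (L * ‖t‖) ≤
        Real.exp (K * ‖x‖) * Real.exp (K * ‖t - x‖) := by
      rw [← Real.exp_add, ← Real.exp_add, ← add_mul, ← mul_add]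
      refine Real.exp_le_exp.mpr (mul_le_mul hK ?_ (norm_nonneg _) (Nat.cast_nonneg _))
      calc ‖t‖ = ‖x + (t - x)‖ := by congr 1; abel
        _ ≤ _ := norm_add_le _ _
    rw [h1]
    have hLn : 0 ≤ L := norm_nonneg _
    calc Real.exp (k * ‖t‖) * ((j.choose i : ℝ) * ‖iteratedFDeriv ℝ i ψ (t - x)‖ *
          ‖iteratedFDeriv ℝ (j - i) (cexpo z) t‖)
        ≤ Real.exp (k * ‖t‖) * ((j.choose i : ℝ) * ‖iteratedFDeriv ℝ i ψ (t - x)‖ *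
          (L ^ (j - i) * Real.exp (L * ‖t‖))) := by gcongr
      _ = (j.choose i : ℝ) * ((Real.exp (k * ‖t‖) * Real.exp (L * ‖t‖)) *
          ‖iteratedFDeriv ℝ i ψ (t - x)‖ * L ^ (j - i)) := by ring
      _ ≤ (j.choose i : ℝ) * ((Real.exp (K * ‖x‖) * Real.exp (K * ‖t - x‖)) *
          ‖iteratedFDeriv ℝ i ψ (t - x)‖ * L ^ (j - i)) := by gcongr
      _ = (j.choose i : ℝ) * (Real.exp (K * ‖x‖) * (Real.exp (K * ‖t - x‖) *
          ‖iteratedFDeriv ℝ i ψ (t - x)‖) * L ^ (j - i)) := by ring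
      _ ≤ _ := by gcongr; exact h2
  refine key.trans (Finset.single_le_sum (f := fun j => ∑ i ∈ Finset.range (j + 1),
    (j.choose i : ℝ) * (Real.exp (K * ‖x‖) * C * L ^ (j - i))) (fun j _ => ?_)
    (Finset.mem_range.mpr (Nat.lt_succ_of_le hj)))
  exact Finset.sum_nonneg fun i _ => by positivity

/-- The test function `t ↦ conj(ψ(t - x)) e^{-2π i z · t}` of `𝒦₁(ℝⁿ)`; for real `z = ξ` it is the
complex conjugate of the time-frequency shift `M_ξ T_x ψ`. -/
def atom {n : ℕ} (ψ : K1 n) (x : RSp n) (z : CSp n) : K1 n :=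
  ⟨fun t => conj (ψ (t - x)) * cexpo z t, atom_mem ψ x z⟩

/-- The STFT `V_ψ f(x, z) = ⟨f, conj(ψ(· - x)) e^{-2π i z · ·}⟩` of `f ∈ 𝒦₁'(ℝⁿ)`,
`x ∈ ℝⁿ`, `z ∈ ℂⁿ`. -/
def stftDist {n : ℕ} (f : K1Dual n) (ψ : K1 n) (x : RSp n) (z : CSp n) : ℂ := f (atom ψ x z)

/-- The STFT `V_ψ g(x, z) = ∫ g(t) conj(ψ(t - x)) e^{-2π i z · t} dt` of a function `g` with respect
to a window function `ψ`. -/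
def stftFun {n : ℕ} (g ψ : RSp n → ℂ) (x : RSp n) (z : CSp n) : ℂ :=
  ∫ t, g t * (conj (ψ (t - x)) * cexpo z t)

/-- The `L²` inner product `(γ, ψ) = ∫ γ(t) conj(ψ(t)) dt`. -/
def ipL2 {n : ℕ} (γ ψ : RSp n → ℂ) : ℂ := ∫ t, γ t * conj (ψ t)

/-- The functional `T` on `𝒦₁(ℝⁿ) ⊗̂ 𝒰(ℂⁿ)` is given by the function `G` on `ℝⁿ × ℂⁿ`, through
`⟨T, Φ⟩ = ∬ G(x, ξ) Φ(x, ξ) dx dξ` over real `x` and `ξ`, with absolutely convergent integrals. -/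
def IsGivenBy {n : ℕ} (T : KUDual n) (G : RSp n → CSp n → ℂ) : Prop :=
  ∀ Φ : KU n,
    Integrable (fun p : RSp n × RSp n => G p.1 (cpt p.2 0) * Φ p.1 (cpt p.2 0)) volume ∧
    T Φ = ∫ p : RSp n × RSp n, G p.1 (cpt p.2 0) * Φ p.1 (cpt p.2 0)

/-- `h` is the adjoint STFT `V_ψ^* F`: for each test function `φ` the function
`conj(V_ψ(conj φ)(x, ξ))` extends to the element
`Θ(x, z) = conj(V_ψ(conj φ)(x, conj z))` of `𝒦₁(ℝⁿ) ⊗̂ 𝒰(ℂⁿ)`, and `⟨h, φ⟩ = ⟨F, Θ⟩`. -/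
def IsAdjointSTFT {n : ℕ} (F : KUDual n) (ψ : K1 n) (h : K1Dual n) : Prop :=
  ∀ φ : K1 n, ∃ Θ : KU n,
    (∀ x z, Θ x z = conj (stftFun (fun t => conj (φ t)) ψ x (conjPt z))) ∧ h φ = F Θ

/-- Hypocontinuity of a map `β : E × F → G` that is additive in each variable: for every bounded
`B ⊆ E` the maps `β(x, ·)`, `x ∈ B`, are equicontinuous, and for every bounded `B ⊆ F` the maps
`β(·, y)`, `y ∈ B`, are equicontinuous. -/
def IsHypocontinuous {E F G : Type*} [AddCommGroup E] [Module ℂ E] [TopologicalSpace E]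
    [AddCommGroup F] [Module ℂ F] [TopologicalSpace F] [AddCommGroup G] [TopologicalSpace G]
    (β : E → F → G) : Prop :=
  (∀ B : Set E, Bornology.IsVonNBounded ℂ B → ∀ W ∈ 𝓝 (0 : G), ∃ U ∈ 𝓝 (0 : F),
    ∀ x ∈ B, ∀ y ∈ U, β x y ∈ W) ∧
  (∀ B : Set F, Bornology.IsVonNBounded ℂ B → ∀ W ∈ 𝓝 (0 : G), ∃ U ∈ 𝓝 (0 : E),
    ∀ y ∈ B, ∀ x ∈ U, β x y ∈ W)

end ExpSTFT

end

open ExpSTFT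

/-!
Both transforms are transposes of continuous maps between test function spaces. *Synthesis*
`(ψ, Φ) ↦ ∬ Φ(x, ξ + iη) conj(ψ(· - x)) e^{-2πi (ξ + iη) · (·)} dx dξ` is a `𝒦₁(ℝⁿ)`-valued
integral, and functionals commute with it: by Hahn–Banach, a functional on `𝒦₁(ℝⁿ)` factors through
a Banach space of weighted jets. So the transpose of synthesis at `η = 0` is `V`. *Analysis*
`(ψ, φ) ↦ ∫ φ(t) ψ(t - x) e^{2πi z·t} dt` takes values in `𝒦₁(ℝⁿ) ⊗̂ 𝒰(ℂⁿ)`, its decay in `z` coming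
from integration by parts, and its transpose is `V^*`. Strongly bounded sets of functionals are
equicontinuous on spaces topologised by countably many seminorms, so a transpose is hypocontinuous
as soon as the original map satisfies seminorm estimates. Finally
`synthesis η ψ ∘ analysis γ = (γ, ψ) • id` for every `η`, by Fourier inversion in `ξ` and
translation invariance in `x`.
-/

noncomputable section

namespace ExpSTFT

section Calculus

variable {P E F : Type*} [NormedAddCommGroup E] [NormedSpace ℝ E]
  [NormedAddCommGroup F] [NormedSpace ℝ F]

lemma hasFDerivAt_integral_iteratedFDeriv [MeasurableSpace P] {μ : Measure P} [CompleteSpace F]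
    {g : P → E → F} (hg : ∀ p, ContDiff ℝ ∞ (g p))
    (hm : ∀ j t, AEStronglyMeasurable (fun p => iteratedFDeriv ℝ j (g p) t) μ)
    {b : ℕ → P → ℝ} (hb : ∀ j, Integrable (b j) μ)
    (hgb : ∀ j p t, ‖iteratedFDeriv ℝ j (g p) t‖ ≤ b j p) (m : ℕ) (x : E) :
    HasFDerivAt (fun y => ∫ p, iteratedFDeriv ℝ m (g p) y ∂μ)
      (∫ p, iteratedFDeriv ℝ (m + 1) (g p) x ∂μ).curryLeft x := by
  have hint : ∀ j t, Integrable (fun p => iteratedFDeriv ℝ j (g p) t) μ := fun j t =>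
    (hb j).mono' (hm j t) (.of_forall fun p => hgb j p t)
  let e : (E [×(m + 1)]→L[ℝ] F) ≃ₗᵢ[ℝ] (E →L[ℝ] E [×m]→L[ℝ] F) :=
    continuousMultilinearCurryLeftEquiv ℝ (fun _ : Fin (m + 1) => E) F
  have he : (∫ p, iteratedFDeriv ℝ (m + 1) (g p) x ∂μ).curryLeft =
      ∫ p, e (iteratedFDeriv ℝ (m + 1) (g p) x) ∂μ :=
    (ContinuousLinearMap.integral_comp_comm (𝕜 := ℝ) (Fₗ := E →L[ℝ] E [×m]→L[ℝ] F)
      e.toContinuousLinearEquiv.toContinuousLinearMap (hint (m + 1) x)).symm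
  rw [he]
  refine hasFDerivAt_integral_of_dominated_of_fderiv_le (bound := b (m + 1))
    (F' := fun x p => e (iteratedFDeriv ℝ (m + 1) (g p) x)) Filter.univ_mem
    (.of_forall fun y => hm m y) (hint m x)
    (e.continuous.comp_aestronglyMeasurable (hm (m + 1) x))
    (.of_forall fun p y _ => (e.norm_map _).trans_le (hgb _ _ _)) (hb (m + 1))
    (.of_forall fun p y _ => ?_)
  have hdiff := ((hg p).differentiable_iteratedFDeriv (m := m)
    (by exact_mod_cast WithTop.coe_lt_top m) y).hasFDerivAt
  convert! hdiff using 1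

lemma hasFTaylorSeriesUpTo_integral [MeasurableSpace P] {μ : Measure P} [CompleteSpace F]
    {g : P → E → F} (hg : ∀ p, ContDiff ℝ ∞ (g p))
    (hm : ∀ j t, AEStronglyMeasurable (fun p => iteratedFDeriv ℝ j (g p) t) μ)
    {b : ℕ → P → ℝ} (hb : ∀ j, Integrable (b j) μ)
    (hgb : ∀ j p t, ‖iteratedFDeriv ℝ j (g p) t‖ ≤ b j p) :
    HasFTaylorSeriesUpTo ∞ (fun t => ∫ p, g p t ∂μ)
      (fun t j => ∫ p, iteratedFDeriv ℝ j (g p) t ∂μ) where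
  zero_eq x :=
    ((continuousMultilinearCurryFin0 ℝ E F).toContinuousLinearEquiv.integral_comp_comm
      (μ := μ) (fun p => iteratedFDeriv ℝ 0 (g p) x)).symm
  fderiv m _ x := hasFDerivAt_integral_iteratedFDeriv hg hm hb hgb m x
  cont m _ := continuous_iff_continuousAt.mpr fun x =>
    (hasFDerivAt_integral_iteratedFDeriv hg hm hb hgb m x).continuousAt

lemma continuous_iteratedFDeriv_right [NormedAddCommGroup P] [NormedSpace ℝ P] {g : P × E → F}
    (hg : ContDiff ℝ ∞ g) (j : ℕ) :
    Continuous fun q : P × E => iteratedFDeriv ℝ j (fun t => g (q.1, t)) q.2 := by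
  have hpartial : ∀ q : P × E, iteratedFDeriv ℝ j (fun t => g (q.1, t)) q.2 =
      (iteratedFDeriv ℝ j g q).compContinuousLinearMap
        fun _ => ContinuousLinearMap.inr ℝ P E := by
    rintro ⟨p, t⟩
    have hshift : (fun t => g (p, t)) =
        (fun q => g (q + (p, 0))) ∘ ContinuousLinearMap.inr ℝ P E := by
      funext s; simp
    have hsmooth : ContDiff ℝ ∞ (fun q => g (q + (p, (0 : E)))) :=
      hg.comp (contDiff_id.add contDiff_const)
    rw [hshift, ContinuousLinearMap.iteratedFDeriv_comp_right _ hsmooth t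
      (i := j) (by exact_mod_cast le_top), iteratedFDeriv_comp_add_right]
    simp
  simp_rw [hpartial]
  exact (ContinuousMultilinearMap.compContinuousLinearMapL (𝕜 := ℝ) (F := F)
    fun _ : Fin j => ContinuousLinearMap.inr ℝ P E).continuous.comp
    (hg.continuous_iteratedFDeriv (by exact_mod_cast le_top))

lemma norm_iteratedFDeriv_mul_le_two_pow {A : Type*} [NormedRing A] [NormedAlgebra ℝ A]
    {f g : E → A} (hf : ContDiff ℝ ∞ f) (hg : ContDiff ℝ ∞ g) {j : ℕ} {t : E} {a b : ℝ}
    (hfa : ∀ i ≤ j, ‖iteratedFDeriv ℝ i f t‖ ≤ a) (hgb : ∀ i ≤ j, ‖iteratedFDeriv ℝ i g t‖ ≤ b) :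
    ‖iteratedFDeriv ℝ j (fun t => f t * g t) t‖ ≤ 2 ^ j * (a * b) := by
  have ha : 0 ≤ a := (norm_nonneg _).trans (hfa 0 j.zero_le)
  refine (norm_iteratedFDeriv_mul_le hf hg t (by exact_mod_cast le_top)).trans ?_
  calc ∑ i ∈ Finset.range (j + 1), (j.choose i : ℝ) * ‖iteratedFDeriv ℝ i f t‖ *
        ‖iteratedFDeriv ℝ (j - i) g t‖
      ≤ ∑ i ∈ Finset.range (j + 1), (j.choose i : ℝ) * (a * b) := by
        refine Finset.sum_le_sum fun i hi => ?_
        rw [mul_assoc]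
        gcongr
        · exact hfa i (Nat.lt_succ_iff.mp (Finset.mem_range.mp hi))
        · exact hgb (j - i) (Nat.sub_le _ _)
    _ = 2 ^ j * (a * b) := by
        rw [← Finset.sum_mul, ← Nat.cast_sum, Nat.sum_range_choose]; norm_num

end Calculus

/-! ### Strongly bounded sets of functionals and transposes -/

section Duality

open Bornology

variable {E F H : Type*} [AddCommGroup E] [Module ℂ E] [TopologicalSpace E]
  [AddCommGroup F] [Module ℂ F]
  [AddCommGroup H] [Module ℂ H] [TopologicalSpace H]
  {p : SeminormFamily ℂ E ℕ} {q : SeminormFamily ℂ F ℕ} {r : SeminormFamily ℂ H ℕ}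

lemma exists_bound_of_continuous (hp : WithSeminorms p) (hmono : Monotone p) (f : E →L[ℂ] ℂ) :
    ∃ (k : ℕ) (C : ℝ), 0 ≤ C ∧ ∀ x, ‖f x‖ ≤ C * p k x := by
  obtain ⟨s, C, -, h⟩ := Seminorm.bound_of_continuous hp
    ((normSeminorm ℂ ℂ).comp f.toLinearMap) (continuous_norm.comp f.continuous)
  have hs : s.sup p ≤ p (s.sup id) := Finset.sup_le fun i hi => hmono (Finset.le_sup (f := id) hi)
  exact ⟨s.sup id, C, C.2, fun x => (h x).trans (mul_le_mul_of_nonneg_left (hs x) C.2)⟩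

lemma exists_seminorm_le_one_and_le_norm {f : E →L[ℂ] ℂ} {s : Seminorm ℂ E} {m : ℝ} (hm : 0 ≤ m)
    {x : E} (hx : m * s x < ‖f x‖) : ∃ y, s y ≤ 1 ∧ m ≤ ‖f y‖ := by
  have hfx : 0 < ‖f x‖ := (mul_nonneg hm (apply_nonneg s x)).trans_lt hx
  refine ⟨((m / ‖f x‖ : ℝ) : ℂ) • x, ?_, ?_⟩
  · rw [map_smul_eq_mul, Complex.norm_real, Real.norm_of_nonneg (by positivity), div_mul_eq_mul_div]
    exact (div_le_one hfx).mpr hx.le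
  · rw [map_smul, norm_smul, Complex.norm_real, Real.norm_of_nonneg (by positivity),
      div_mul_cancel₀ _ hfx.ne']

lemma isVonNBounded_range_of_le_one (hp : WithSeminorms p) (hmono : Monotone p) {x : ℕ → E}
    (hx : ∀ m, p m (x m) ≤ 1) : IsVonNBounded ℂ (Set.range x) := by
  refine (hp.isVonNBounded_iff_seminorm_bddAbove).mpr fun i => ?_
  refine ⟨1 + ∑ m ∈ Finset.range i, p i (x m), ?_⟩
  rintro _ ⟨_, ⟨m, rfl⟩, rfl⟩
  have hsum : 0 ≤ ∑ m ∈ Finset.range i, p i (x m) := Finset.sum_nonneg fun _ _ => apply_nonneg _ _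
  rcases lt_or_ge m i with h | h
  · exact (Finset.single_le_sum (f := fun m => p i (x m)) (fun _ _ => apply_nonneg _ _)
      (Finset.mem_range.mpr h)).trans (le_add_of_nonneg_left zero_le_one)
  · exact ((hmono h (x m)).trans (hx m)).trans (le_add_of_nonneg_right hsum)

/-- Were the set not equicontinuous, some sequence `fₘ` in it would be at least `m` at points `xₘ`
with `p m xₘ ≤ 1`; these points form a bounded set. -/
lemma exists_bound_of_isVonNBounded [IsTopologicalAddGroup E] [ContinuousSMul ℂ E]
    (hp : WithSeminorms p) (hmono : Monotone p) {B : Set (E →L[ℂ] ℂ)} (hB : IsVonNBounded ℂ B) :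
    ∃ (k : ℕ) (C : ℝ), 0 ≤ C ∧ ∀ f ∈ B, ∀ x, ‖f x‖ ≤ C * p k x := by
  by_contra! hcon
  have hlarge : ∀ m : ℕ, ∃ f ∈ B, ∃ x, p m x ≤ 1 ∧ (m : ℝ) ≤ ‖f x‖ := by
    intro m
    obtain ⟨f, hf, x, hx⟩ := hcon m m (Nat.cast_nonneg m)
    exact ⟨f, hf, exists_seminorm_le_one_and_le_norm (Nat.cast_nonneg m) hx⟩
  choose f hf x hx hfx using hlarge
  have himage := ContinuousLinearMap.isVonNBounded_image2_apply hB
    (isVonNBounded_range_of_le_one hp hmono hx)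
  obtain ⟨C, hC⟩ := (NormedSpace.isVonNBounded_iff' ℂ).mp himage
  obtain ⟨m, hm⟩ := exists_nat_gt C
  exact absurd (hC _ (Set.mem_image2_of_mem (hf m) ⟨m, rfl⟩)) (not_le.mpr (hm.trans_le (hfx m)))

lemma exists_isVonNBounded_of_mem_nhds_zero [IsTopologicalAddGroup E] [ContinuousSMul ℂ E]
    {W : Set (E →L[ℂ] ℂ)} (hW : W ∈ 𝓝 0) :
    ∃ (S : Set E) (ε : ℝ), IsVonNBounded ℂ S ∧ 0 < ε ∧
      ∀ f : E →L[ℂ] ℂ, (∀ x ∈ S, ‖f x‖ < ε) → f ∈ W := by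
  obtain ⟨⟨S, ε⟩, ⟨hS, hε⟩, h⟩ := (ContinuousLinearMap.hasBasis_nhds_zero_of_basis
    (Metric.nhds_basis_ball (x := (0 : ℂ)))).mem_iff.mp hW
  exact ⟨S, ε, hS, hε, fun f hf => h fun x hx => by simpa using hf x hx⟩

/-- The estimate `r_k (b y x) ≤ C · q_N y · p_N x` that characterises continuity of a (sesqui)linear
map `b : F × E → H` between spaces topologised by increasing sequences of seminorms. -/
def IsBoundedBilin (p : SeminormFamily ℂ E ℕ) (q : SeminormFamily ℂ F ℕ) (r : SeminormFamily ℂ H ℕ)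
    (b : F → E → H) : Prop :=
  ∀ k, ∃ (N : ℕ) (C : ℝ), 0 ≤ C ∧ ∀ y x, r k (b y x) ≤ C * (q N y * p N x)

namespace IsBoundedBilin

variable {σ : ℂ →+* ℂ} {b : F →ₛₗ[σ] E →ₗ[ℂ] H}

lemma continuous_right (hb : IsBoundedBilin p q r fun y x => b y x)
    (hp : WithSeminorms p) (hr : WithSeminorms r) (y : F) : Continuous (b y) := by
  refine WithSeminorms.continuous_of_isBounded (τ₁₂ := RingHom.id ℂ) hp hr (b y) fun k => ?_
  obtain ⟨N, C, hC, h⟩ := hb k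
  refine ⟨{N}, Real.toNNReal (C * q N y), fun x => ?_⟩
  rw [Finset.sup_singleton]
  change r k (b y x) ≤ Real.toNNReal (C * q N y) * p N x
  rw [Real.coe_toNNReal _ (mul_nonneg hC (apply_nonneg _ _)), mul_assoc]
  exact h y x

lemma isVonNBounded_image2 [TopologicalSpace F] {b : F → E → H} (hb : IsBoundedBilin p q r b)
    (hp : WithSeminorms p) (hq : WithSeminorms q) (hr : WithSeminorms r) {B : Set F}
    (hB : IsVonNBounded ℂ B) {S : Set E} (hS : IsVonNBounded ℂ S) :
    IsVonNBounded ℂ (Set.image2 b B S) := by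
  refine hr.isVonNBounded_iff_seminorm_bounded.mpr fun k => ?_
  obtain ⟨N, C, hC, h⟩ := hb k
  obtain ⟨M, hM, hBM⟩ := hq.isVonNBounded_iff_seminorm_bounded.mp hB N
  obtain ⟨L, hL, hSL⟩ := hp.isVonNBounded_iff_seminorm_bounded.mp hS N
  refine ⟨C * (M * L) + 1, by positivity, ?_⟩
  rintro _ ⟨y, hy, x, hx, rfl⟩
  have hyM := (hBM y hy).le
  have hxL := (hSL x hx).le
  calc r k (b y x) ≤ C * (q N y * p N x) := h y x
    _ ≤ C * (M * L) := by gcongr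
    _ < C * (M * L) + 1 := lt_add_one _

end IsBoundedBilin

variable {σ : ℂ →+* ℂ} (b : F →ₛₗ[σ] E →ₗ[ℂ] H)

/-- The transpose `(f, y) ↦ f ∘ b(y, ·)` of a (sesqui)linear map `b : F × E → H`, as a map
`H' × F → E'`. -/
def transpose (hb : ∀ y, Continuous (b y)) :
    (H →L[ℂ] ℂ) →ₗ[ℂ] F →ₛₗ[σ] E →L[ℂ] ℂ :=
  LinearMap.mk₂'ₛₗ (RingHom.id ℂ) σ (fun f y => f.comp ⟨b y, hb y⟩)
    (fun _ _ _ => rfl) (fun _ _ _ => rfl)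
    (fun f y y' => by ext x; simp) (fun c f y => by ext x; simp)

variable [IsTopologicalAddGroup E] [ContinuousSMul ℂ E] [IsTopologicalAddGroup H]
  [ContinuousSMul ℂ H] {b}

lemma isHypocontinuous_transpose [TopologicalSpace F] (hp : WithSeminorms p) (hq : WithSeminorms q)
    (hr : WithSeminorms r) (hr_mono : Monotone r) (hb : IsBoundedBilin p q r fun y x => b y x)
    (hcont : ∀ y, Continuous (b y)) : IsHypocontinuous fun f y => transpose b hcont f y := by
  constructor <;> intro B hB W hW <;>
    obtain ⟨S, ε, hS, hε, hSW⟩ := exists_isVonNBounded_of_mem_nhds_zero hW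
  · obtain ⟨k, C, hC, hBC⟩ := exists_bound_of_isVonNBounded hr hr_mono hB
    obtain ⟨N, D, hD, hbD⟩ := hb k
    obtain ⟨M, -, hSM⟩ := hp.isVonNBounded_iff_seminorm_bounded.mp hS N
    obtain ⟨δ, hδ, hδε⟩ := exists_pos_mul_lt hε (C * D * M)
    refine ⟨(q N).ball 0 δ, (hq.mem_nhds_iff _ _).mpr ⟨{N}, δ, hδ, by simp⟩,
      fun f hf y hy => hSW _ fun x hx => ?_⟩
    have hyδ : q N y < δ := by simpa using hy
    calc ‖f (b y x)‖ ≤ C * r k (b y x) := hBC f hf _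
      _ ≤ C * (D * (q N y * p N x)) := by gcongr; exact hbD y x
      _ ≤ C * (D * (δ * M)) := by gcongr; exact (hSM x hx).le
      _ = C * D * M * δ := by ring
      _ < ε := hδε
  · have himage := hb.isVonNBounded_image2 hp hq hr hB hS
    refine ⟨_, ContinuousLinearMap.eventually_nhds_zero_mapsTo himage
      (Metric.ball_mem_nhds (0 : ℂ) hε), fun y hy f hf => hSW _ fun x hx => ?_⟩
    exact mem_ball_zero_iff.mp (hf (Set.mem_image2_of_mem hy hx))

end Duality

variable {n : ℕ}

/-! ### Test functions -/

namespace K1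

@[ext] lemma ext {φ χ : K1 n} (h : ∀ t, φ t = χ t) : φ = χ := DFunLike.ext _ _ h

lemma contDiff (φ : K1 n) : ContDiff ℝ ∞ φ := φ.2.1

lemma continuous (φ : K1 n) : Continuous φ := φ.contDiff.continuous

@[simp] lemma add_apply (φ χ : K1 n) (t : RSp n) : (φ + χ) t = φ t + χ t := rfl

@[simp] lemma smul_apply (c : ℂ) (φ : K1 n) (t : RSp n) : (c • φ) t = c * φ t := rfl

lemma wder_le_nu (φ : K1 n) {j k : ℕ} (hj : j ≤ k) (t : RSp n) : wder k φ j t ≤ nu n k φ :=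
  le_ciSup (φ.bdd k) (⟨j, Nat.lt_succ_of_le hj⟩, t)

lemma nu_le {φ : K1 n} {k : ℕ} {C : ℝ} (h : ∀ j ≤ k, ∀ t, wder k φ j t ≤ C) : nu n k φ ≤ C :=
  ciSup_le fun p => h p.1 (Nat.lt_succ_iff.mp p.1.2) p.2

lemma norm_iteratedFDeriv_le (φ : K1 n) {j k : ℕ} (hj : j ≤ k) (t : RSp n) :
    ‖iteratedFDeriv ℝ j φ t‖ ≤ nu n k φ * Real.exp (-(k * ‖t‖)) := by
  rw [Real.exp_neg, ← div_eq_mul_inv, le_div_iff₀ (Real.exp_pos _), mul_comm]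
  exact φ.wder_le_nu hj t

lemma norm_iteratedFDeriv_le_nu (φ : K1 n) {j k : ℕ} (hj : j ≤ k) (t : RSp n) :
    ‖iteratedFDeriv ℝ j φ t‖ ≤ nu n k φ :=
  (φ.norm_iteratedFDeriv_le hj t).trans
    (mul_le_of_le_one_right (apply_nonneg _ _)
      (Real.exp_le_one_iff.mpr (neg_nonpos.mpr (by positivity))))

lemma norm_le (φ : K1 n) (k : ℕ) (t : RSp n) : ‖φ t‖ ≤ nu n k φ * Real.exp (-(k * ‖t‖)) := by
  simpa using φ.norm_iteratedFDeriv_le (Nat.zero_le k) t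

lemma wder_mono {φ : RSp n → ℂ} {k l : ℕ} (h : k ≤ l) (j : ℕ) (t : RSp n) :
    wder k φ j t ≤ wder l φ j t := by
  unfold wder
  gcongr

lemma nu_mono : Monotone (nuFamily n) := fun _ _ h φ =>
  nu_le fun j hj t => (wder_mono h j t).trans (φ.wder_le_nu (hj.trans h) t)

lemma wder_conj (k : ℕ) (φ : RSp n → ℂ) (j : ℕ) (t : RSp n) :
    wder k (fun t => conj (φ t)) j t = wder k φ j t :=
  congrArg _ (Complex.conjLIE.norm_iteratedFDeriv_comp_left (𝕜 := ℝ) φ t j)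

/-- The complex conjugate of a test function. -/
def conjugate (φ : K1 n) : K1 n :=
  ⟨fun t => conj (φ t), Complex.conjCLE.contDiff.comp φ.contDiff, fun k => ⟨nu n k φ,
    fun j hj t => (wder_conj k φ j t).trans_le (φ.wder_le_nu hj t)⟩⟩

@[simp] lemma conjugate_apply (φ : K1 n) (t : RSp n) : φ.conjugate t = conj (φ t) := rfl

lemma nu_conjugate_le (k : ℕ) (φ : K1 n) : nu n k φ.conjugate ≤ nu n k φ :=
  nu_le fun j hj t => (wder_conj k φ j t).trans_le (φ.wder_le_nu hj t)

lemma wder_comp_sub_left_le (φ : K1 n) (t : RSp n) {j k : ℕ} (hj : j ≤ k) (x : RSp n) :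
    wder k (fun x => φ (t - x)) j x ≤ Real.exp (k * ‖t‖) * nu n k φ := by
  have hderiv : ‖iteratedFDeriv ℝ j (fun x => φ (t - x)) x‖ = ‖iteratedFDeriv ℝ j φ (t - x)‖ := by
    have h := (LinearIsometryEquiv.neg ℝ (E := RSp n)).norm_iteratedFDeriv_comp_right
      (𝕜 := ℝ) (fun y => φ (t + y)) x j
    rw [iteratedFDeriv_comp_add_left] at h
    simpa [Function.comp_def, ← sub_eq_add_neg] using h
  have hx : ‖x‖ ≤ ‖t‖ + ‖t - x‖ := by simpa using norm_sub_le t (t - x)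
  calc wder k (fun x => φ (t - x)) j x
      ≤ Real.exp (k * (‖t‖ + ‖t - x‖)) * ‖iteratedFDeriv ℝ j φ (t - x)‖ := by
        rw [wder, hderiv]; gcongr
    _ = Real.exp (k * ‖t‖) * wder k φ j (t - x) := by
        rw [mul_add, Real.exp_add, mul_assoc, wder]
    _ ≤ Real.exp (k * ‖t‖) * nu n k φ := by gcongr; exact φ.wder_le_nu hj _

/-- The reflected translate `x ↦ φ(t - x)` of a test function. -/
def constSub (φ : K1 n) (t : RSp n) : K1 n :=
  ⟨fun x => φ (t - x), φ.contDiff.comp (contDiff_const.sub contDiff_id), fun _ => ⟨_,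
    fun _ hj => φ.wder_comp_sub_left_le t hj⟩⟩

@[simp] lemma constSub_apply (φ : K1 n) (t x : RSp n) : φ.constSub t x = φ (t - x) := rfl

lemma nu_constSub_le (k : ℕ) (φ : K1 n) (t : RSp n) :
    nu n k (φ.constSub t) ≤ Real.exp (k * ‖t‖) * nu n k φ :=
  nu_le fun _ hj => φ.wder_comp_sub_left_le t hj

lemma wder_fderiv_apply_le (φ : K1 n) (v : RSp n) {j k : ℕ} (hj : j ≤ k) (t : RSp n) :
    wder k (fun t => fderiv ℝ φ t v) j t ≤ ‖v‖ * nu n (k + 1) φ := by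
  have hderiv : ‖iteratedFDeriv ℝ j (fun t => fderiv ℝ φ t v) t‖ ≤
      ‖v‖ * ‖iteratedFDeriv ℝ (j + 1) φ t‖ := by
    rw [← norm_iteratedFDeriv_fderiv]
    exact norm_iteratedFDeriv_clm_apply_const
      (φ.contDiff.fderiv_right (m := ∞) le_rfl).contDiffAt (by exact_mod_cast le_top)
  calc wder k (fun t => fderiv ℝ φ t v) j t
      ≤ Real.exp (k * ‖t‖) * (‖v‖ * ‖iteratedFDeriv ℝ (j + 1) φ t‖) := by
        unfold wder; gcongr
    _ = ‖v‖ * wder k φ (j + 1) t := by unfold wder; ring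
    _ ≤ ‖v‖ * nu n (k + 1) φ := by
        gcongr
        exact (wder_mono k.le_succ _ t).trans (φ.wder_le_nu (Nat.succ_le_succ hj) t)

/-- The directional derivative `∂_v φ` of a test function. -/
def dirDeriv (v : RSp n) (φ : K1 n) : K1 n :=
  ⟨fun t => fderiv ℝ φ t v, (φ.contDiff.fderiv_right (m := ∞) le_rfl).clm_apply contDiff_const,
    fun _ => ⟨_, fun _ hj => φ.wder_fderiv_apply_le v hj⟩⟩

@[simp] lemma dirDeriv_apply (v : RSp n) (φ : K1 n) (t : RSp n) :
    dirDeriv v φ t = fderiv ℝ φ t v := rfl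

lemma nu_dirDeriv_le (k : ℕ) (v : RSp n) (φ : K1 n) :
    nu n k (dirDeriv v φ) ≤ ‖v‖ * nu n (k + 1) φ :=
  nu_le fun _ hj => φ.wder_fderiv_apply_le v hj

end K1

namespace KU

@[ext] lemma ext {Φ Ψ : KU n} (h : ∀ x z, Φ x z = Ψ x z) : Φ = Ψ :=
  DFunLike.ext _ _ fun x => funext (h x)

@[simp] lemma add_apply (Φ Ψ : KU n) (x : RSp n) (z : CSp n) : (Φ + Ψ) x z = Φ x z + Ψ x z := rfl

@[simp] lemma smul_apply (c : ℂ) (Φ : KU n) (x : RSp n) (z : CSp n) :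
    (c • Φ) x z = c * Φ x z := rfl

lemma wderU_le_rho (Φ : KU n) {j k : ℕ} (hj : j ≤ k) (x : RSp n) {z : CSp n}
    (hz : z ∈ tube n k) : wderU k Φ j x z ≤ rho n k Φ :=
  le_ciSup (Φ.bdd k) (⟨j, Nat.lt_succ_of_le hj⟩, x, ⟨z, hz⟩)

lemma rho_le {Φ : KU n} {k : ℕ} {C : ℝ}
    (h : ∀ j ≤ k, ∀ x, ∀ z ∈ tube n k, wderU k Φ j x z ≤ C) : rho n k Φ ≤ C :=
  ciSup_le fun p => h p.1 (Nat.lt_succ_iff.mp p.1.2) p.2.1 p.2.2 p.2.2.2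

lemma tube_mono {k l : ℕ} (h : k ≤ l) : tube n k ⊆ tube n l := fun _ hz i =>
  (hz i).trans (by exact_mod_cast h)

lemma rho_mono : Monotone (rhoFamily n) := fun k l h Φ => by
  refine rho_le fun j hj x z hz => le_trans ?_ (Φ.wderU_le_rho (hj.trans h) x (tube_mono h hz))
  have hone : 1 ≤ 1 + ‖z‖ ^ 2 := le_add_of_nonneg_right (sq_nonneg _)
  unfold wderU
  gcongr ?_ * ?_
  · unfold wder; positivity
  · exact Real.rpow_le_rpow_of_exponent_le hone (by gcongr)
  · exact K1.wder_mono h j x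

end KU

/-! ### Exponentials and atoms -/

lemma expoForm_apply (z : CSp n) (t : RSp n) :
    expoForm z t = -2 * Real.pi * Complex.I * cdot z t := by
  simp only [cdot, expoForm, Finset.mul_sum, _root_.sum_apply,
    ContinuousLinearMap.smulRight_apply, PiLp.proj_apply, Complex.real_smul]
  exact Finset.sum_congr rfl fun i _ => by ring

lemma norm_cdot_le (z : CSp n) (t : RSp n) : ‖cdot z t‖ ≤ ‖z‖ * ‖t‖ := by
  calc ‖cdot z t‖ ≤ ∑ i, ‖z i‖ * ‖t i‖ :=
        norm_sum_le_of_le _ fun i _ => by rw [norm_mul, Complex.norm_real]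
    _ ≤ ‖z‖ * ‖t‖ := by
        rw [EuclideanSpace.norm_eq, EuclideanSpace.norm_eq]
        exact Real.sum_mul_le_sqrt_mul_sqrt _ _ _

lemma norm_expoForm_le (z : CSp n) : ‖expoForm z‖ ≤ 2 * Real.pi * ‖z‖ := by
  refine ContinuousLinearMap.opNorm_le_bound _ (by positivity) fun t => ?_
  rw [expoForm_apply, norm_mul, mul_assoc (2 * Real.pi)]
  gcongr
  · simp [abs_of_nonneg Real.pi_pos.le]
  · exact norm_cdot_le z t

/-- An exponent `m'` for which `|e^{-2πi z·t}| ≤ e^{m'|t|}` when `z ∈ Π_m`. -/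
def expRate (n m : ℕ) : ℕ := ⌈2 * Real.pi * n * m⌉₊

lemma norm_cexpo_le {m : ℕ} {z : CSp n} (hz : z ∈ tube n m) (t : RSp n) :
    ‖cexpo z t‖ ≤ Real.exp (expRate n m * ‖t‖) := by
  have him : (cdot z t).im ≤ n * m * ‖t‖ := by
    calc (cdot z t).im = ∑ i, (z i).im * t i := by simp [cdot, Complex.im_sum, Complex.mul_im]
      _ ≤ ∑ _i : Fin n, m * ‖t‖ := by
          refine Finset.sum_le_sum fun i _ => (le_abs_self _).trans ?_
          rw [abs_mul]
          exact mul_le_mul (hz i) (PiLp.norm_apply_le t i) (abs_nonneg _) (Nat.cast_nonneg _)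
      _ = n * m * ‖t‖ := by simp [mul_assoc]
  rw [cexpo, Complex.norm_exp]
  refine Real.exp_le_exp.mpr ?_
  calc (-2 * (Real.pi : ℂ) * Complex.I * cdot z t).re = 2 * Real.pi * (cdot z t).im := by
        simp [Complex.mul_re, Complex.mul_im]
    _ ≤ 2 * Real.pi * (n * m * ‖t‖) := by gcongr
    _ = 2 * Real.pi * n * m * ‖t‖ := by ring
    _ ≤ expRate n m * ‖t‖ := by gcongr; exact Nat.le_ceil _

lemma hasFDerivAt_cexpo (z : CSp n) (t : RSp n) :
    HasFDerivAt (cexpo z) (cexpo z t • expoForm z) t := by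
  rw [cexpo_eq]
  exact ((expoForm z).hasFDerivAt (x := t)).cexp

lemma norm_iteratedFDeriv_cexpo_le (z : CSp n) (j : ℕ) (t : RSp n) :
    ‖iteratedFDeriv ℝ j (cexpo z) t‖ ≤ ‖expoForm z‖ ^ j * ‖cexpo z t‖ := by
  induction j with
  | zero => simp
  | succ j ih =>
    have hderiv : fderiv ℝ (cexpo z) =
        (ContinuousLinearMap.toSpanSingleton ℂ (expoForm z)).restrictScalars ℝ ∘ cexpo z :=
      funext fun s => (hasFDerivAt_cexpo z s).fderiv
    rw [← norm_iteratedFDeriv_fderiv, hderiv]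
    refine (ContinuousLinearMap.norm_iteratedFDeriv_comp_left _ (N := ∞)
      (contDiff_cexpo z).contDiffAt (by exact_mod_cast le_top)).trans ?_
    rw [ContinuousLinearMap.norm_restrictScalars, ContinuousLinearMap.norm_toSpanSingleton,
      pow_succ', mul_assoc]
    exact mul_le_mul_of_nonneg_left ih (norm_nonneg _)

lemma norm_iteratedFDeriv_cexpo_le_exp {m j k : ℕ} (hj : j ≤ k) {z : CSp n} (hz : z ∈ tube n m)
    (t : RSp n) : ‖iteratedFDeriv ℝ j (cexpo z) t‖ ≤
      (2 * Real.pi * (1 + ‖z‖)) ^ k * Real.exp (expRate n m * ‖t‖) := by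
  have hbase : 1 ≤ 2 * Real.pi * (1 + ‖z‖) := by
    nlinarith [Real.pi_gt_three, norm_nonneg z]
  have hform : ‖expoForm z‖ ≤ 2 * Real.pi * (1 + ‖z‖) :=
    (norm_expoForm_le z).trans (by gcongr; exact le_add_of_nonneg_left zero_le_one)
  calc ‖iteratedFDeriv ℝ j (cexpo z) t‖ ≤ ‖expoForm z‖ ^ j * ‖cexpo z t‖ :=
        norm_iteratedFDeriv_cexpo_le z j t
    _ ≤ (2 * Real.pi * (1 + ‖z‖)) ^ j * Real.exp (expRate n m * ‖t‖) := by
        gcongr; exact norm_cexpo_le hz t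
    _ ≤ (2 * Real.pi * (1 + ‖z‖)) ^ k * Real.exp (expRate n m * ‖t‖) := by gcongr

lemma exp_neg_norm_sub_le {E : Type*} [SeminormedAddCommGroup E] {r : ℝ} (hr : 0 ≤ r) (x t : E) :
    Real.exp (-(r * ‖t - x‖)) ≤ Real.exp (r * ‖x‖) * Real.exp (-(r * ‖t‖)) := by
  have h : ‖t‖ ≤ ‖t - x‖ + ‖x‖ := by simpa using norm_add_le (t - x) x
  rw [← Real.exp_add]
  exact Real.exp_le_exp.mpr (by linarith [mul_le_mul_of_nonneg_left h hr])

lemma K1.norm_iteratedFDeriv_comp_sub_le (φ : K1 n) {j k : ℕ} (hj : j ≤ k) (x t : RSp n) :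
    ‖iteratedFDeriv ℝ j (fun t => φ (t - x)) t‖ ≤
      nu n k φ * (Real.exp (k * ‖x‖) * Real.exp (-(k * ‖t‖))) := by
  rw [iteratedFDeriv_comp_sub]
  refine (φ.norm_iteratedFDeriv_le hj _).trans ?_
  gcongr
  exact exp_neg_norm_sub_le (Nat.cast_nonneg k) x t

lemma nu_atom_le (ψ : K1 n) (x : RSp n) {k m : ℕ} {z : CSp n} (hz : z ∈ tube n m) :
    K1.nu n k (atom ψ x z) ≤ (4 * Real.pi) ^ k * K1.nu n (k + expRate n m) ψ *
      (Real.exp ((k + expRate n m) * ‖x‖) * (1 + ‖z‖) ^ k) := by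
  refine K1.nu_le fun j hj t => ?_
  have hproduct := norm_iteratedFDeriv_mul_le_two_pow (j := j) (t := t)
    (ψ.conjugate.contDiff.comp (contDiff_id.sub contDiff_const)) (contDiff_cexpo z)
    (fun i hi => ψ.conjugate.norm_iteratedFDeriv_comp_sub_le
      ((hi.trans hj).trans (Nat.le_add_right k (expRate n m))) x t)
    (fun i hi => norm_iteratedFDeriv_cexpo_le_exp (hi.trans hj) hz t)
  have hexp : Real.exp (k * ‖t‖) * Real.exp (-((k + expRate n m : ℕ) * ‖t‖)) *
      Real.exp (expRate n m * ‖t‖) = 1 := by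
    rw [← Real.exp_add, ← Real.exp_add, Real.exp_eq_one_iff]
    push_cast
    ring
  calc wder k (atom ψ x z) j t
      ≤ Real.exp (k * ‖t‖) * (2 ^ j * (K1.nu n (k + expRate n m) ψ.conjugate *
          (Real.exp ((k + expRate n m : ℕ) * ‖x‖) * Real.exp (-((k + expRate n m : ℕ) * ‖t‖))) *
          ((2 * Real.pi * (1 + ‖z‖)) ^ k * Real.exp (expRate n m * ‖t‖)))) :=
        mul_le_mul_of_nonneg_left hproduct (Real.exp_pos _).le
    _ = 2 ^ j * (2 * Real.pi) ^ k * K1.nu n (k + expRate n m) ψ.conjugate *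
          (Real.exp ((k + expRate n m) * ‖x‖) * (1 + ‖z‖) ^ k) := by
        rw [mul_pow (2 * Real.pi)]
        push_cast at hexp ⊢
        linear_combination (2 ^ j * (2 * Real.pi) ^ k * K1.nu n (k + expRate n m) ψ.conjugate *
          (Real.exp ((k + expRate n m) * ‖x‖) * (1 + ‖z‖) ^ k)) * hexp
    _ ≤ 2 ^ k * (2 * Real.pi) ^ k * K1.nu n (k + expRate n m) ψ *
          (Real.exp ((k + expRate n m) * ‖x‖) * (1 + ‖z‖) ^ k) := by
        gcongr
        · norm_num
        · exact K1.nu_conjugate_le _ ψ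
    _ = _ := by rw [← mul_pow, ← mul_assoc 2]; norm_num

/-! ### Continuous families of test functions and their integrals -/

namespace K1

section Continuity

lemma wder_le_mul_exp_neg (φ : K1 n) {j k : ℕ} (hj : j ≤ k) (t : RSp n) :
    wder k φ j t ≤ nu n (k + 1) φ * Real.exp (-‖t‖) := by
  have hexp : Real.exp (k * ‖t‖) * Real.exp (-((k + 1 : ℕ) * ‖t‖)) = Real.exp (-‖t‖) := by
    rw [← Real.exp_add]; congr 1; push_cast; ring
  calc wder k φ j t
      ≤ Real.exp (k * ‖t‖) * (nu n (k + 1) φ * Real.exp (-((k + 1 : ℕ) * ‖t‖))) := by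
        unfold wder; gcongr; exact φ.norm_iteratedFDeriv_le (hj.trans k.le_succ) t
    _ = nu n (k + 1) φ * Real.exp (-‖t‖) := by rw [mul_left_comm, hexp]

lemma iteratedFDeriv_sub (φ χ : K1 n) (j : ℕ) (t : RSp n) :
    iteratedFDeriv ℝ j (φ - χ : K1 n) t = iteratedFDeriv ℝ j φ t - iteratedFDeriv ℝ j χ t :=
  iteratedFDeriv_sub_apply (φ.contDiff.of_le (by exact_mod_cast le_top)).contDiffAt
    (χ.contDiff.of_le (by exact_mod_cast le_top)).contDiffAt

variable {P : Type*} [NormedAddCommGroup P] [NormedSpace ℝ P] {a : P → K1 n}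

lemma eventually_wder_sub_lt (ha : ContDiff ℝ ∞ fun q : P × RSp n => a q.1 q.2) (p₀ : P) (k : ℕ)
    (R : ℝ) {ε : ℝ} (hε : 0 < ε) : ∀ᶠ p in 𝓝 p₀, ∀ j : Fin (k + 1),
      ∀ t ∈ Metric.closedBall (0 : RSp n) R, wder k (a p - a p₀ : K1 n) j t < ε := by
  refine Filter.eventually_all.mpr fun j =>
    (isCompact_closedBall (0 : RSp n) R).eventually_forall_of_forall_eventually fun t _ => ?_
  have hweight : Continuous fun q : P × RSp n => Real.exp (k * ‖q.2‖) := by fun_prop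
  have hderiv : Continuous fun q : P × RSp n => iteratedFDeriv ℝ j (a p₀) q.2 :=
    ((a p₀).contDiff.continuous_iteratedFDeriv (by exact_mod_cast le_top)).comp continuous_snd
  have hcont : Continuous fun q : P × RSp n => wder k (a q.1 - a p₀ : K1 n) j q.2 := by
    simp only [wder, iteratedFDeriv_sub]
    exact hweight.mul ((continuous_iteratedFDeriv_right ha j).sub hderiv).norm
  refine hcont.continuousAt.eventually_lt continuousAt_const ?_
  rwa [wder, iteratedFDeriv_sub, sub_self, norm_zero, mul_zero]

/-- The derivatives converge uniformly on compact sets by joint smoothness, and a bound on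
`ν_{k+1}` makes the tails of `ν_k` uniformly small. -/
lemma continuous_of_contDiff (ha : ContDiff ℝ ∞ fun q : P × RSp n => a q.1 q.2)
    (hbound : ∀ k, ∃ b : P → ℝ, Continuous b ∧ ∀ p, nu n k (a p) ≤ b p) : Continuous a := by
  refine continuous_iff_continuousAt.mpr fun p₀ =>
    ((withSeminorms n).tendsto_nhds _ _).mpr fun k ε hε => ?_
  obtain ⟨b, hb, hab⟩ := hbound (k + 1)
  obtain ⟨R, hR⟩ : ∃ R : ℝ, ∀ r ≥ R, (b p₀ + 1 + b p₀) * Real.exp (-r) ≤ ε / 2 := by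
    have hlim := Real.tendsto_exp_neg_atTop_nhds_zero.const_mul (b p₀ + 1 + b p₀)
    rw [mul_zero] at hlim
    exact Filter.eventually_atTop.mp (hlim.eventually_le_const (half_pos hε))
  filter_upwards [hb.continuousAt.eventually_le_const (lt_add_one _),
    eventually_wder_sub_lt ha p₀ k R (half_pos hε)] with p hbp hnear
  refine (nu_le fun j hj t => ?_).trans_lt (half_lt_self hε)
  rcases le_total ‖t‖ R with ht | ht
  · exact (hnear ⟨j, Nat.lt_succ_of_le hj⟩ t (by simpa using ht)).le
  · calc wder k (a p - a p₀ : K1 n) j t ≤ nu n (k + 1) (a p - a p₀) * Real.exp (-‖t‖) :=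
          (a p - a p₀).wder_le_mul_exp_neg hj t
      _ ≤ (b p₀ + 1 + b p₀) * Real.exp (-‖t‖) := by
          gcongr
          exact (map_sub_le_add _ _ _).trans (add_le_add ((hab p).trans hbp) (hab p₀))
      _ ≤ ε / 2 := hR _ ht

end Continuity

section Jet

/-- The Banach space of bounded continuous functions on `ℝⁿ` with values in the `j`-linear forms.
It is a type of its own to keep instance search on products of such spaces short. -/
def FormField (n j : ℕ) : Type := BoundedContinuousFunction (RSp n) ((RSp n) [×j]→L[ℝ] ℂ)

instance (n j : ℕ) : NormedAddCommGroup (FormField n j) :=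
  inferInstanceAs (NormedAddCommGroup (BoundedContinuousFunction (RSp n) ((RSp n) [×j]→L[ℝ] ℂ)))

instance (n j : ℕ) : NormedSpace ℂ (FormField n j) :=
  inferInstanceAs (NormedSpace ℂ (BoundedContinuousFunction (RSp n) ((RSp n) [×j]→L[ℝ] ℂ)))

instance (n j : ℕ) : CompleteSpace (FormField n j) :=
  inferInstanceAs (CompleteSpace (BoundedContinuousFunction (RSp n) ((RSp n) [×j]→L[ℝ] ℂ)))

/-- Evaluation of a field of `j`-linear forms at the point `t`. -/
def FormField.eval {j : ℕ} (t : RSp n) : FormField n j →L[ℂ] (RSp n) [×j]→L[ℝ] ℂ :=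
  BoundedContinuousFunction.evalCLM ℂ t

lemma norm_exp_smul_iteratedFDeriv_le (φ : K1 n) {j k : ℕ} (hj : j ≤ k) (t : RSp n) :
    ‖Real.exp (k * ‖t‖) • iteratedFDeriv ℝ j φ t‖ ≤ nu n k φ := by
  rw [norm_smul, Real.norm_of_nonneg (Real.exp_pos _).le]
  exact φ.wder_le_nu hj t

/-- The weighted derivative `t ↦ e^{k|t|} φ^{(j)}(t)`, `j ≤ k`, as a bounded continuous function. -/
def weightedDeriv (k : ℕ) (j : Fin (k + 1)) : K1 n →ₗ[ℂ] FormField n j where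
  toFun φ := BoundedContinuousFunction.ofNormedAddCommGroup
    (fun t => Real.exp (k * ‖t‖) • iteratedFDeriv ℝ j φ t)
    ((by fun_prop : Continuous fun t : RSp n => Real.exp (k * ‖t‖)).smul
      (φ.contDiff.continuous_iteratedFDeriv (by exact_mod_cast le_top))) (nu n k φ)
    (φ.norm_exp_smul_iteratedFDeriv_le (Nat.lt_succ_iff.mp j.2))
  map_add' φ χ := BoundedContinuousFunction.ext fun t => by
    have h : iteratedFDeriv ℝ (j : ℕ) ((φ + χ : K1 n) : RSp n → ℂ) t = _ :=
      iteratedFDeriv_add_apply (φ.contDiff.of_le (by exact_mod_cast le_top)).contDiffAt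
        (χ.contDiff.of_le (by exact_mod_cast le_top)).contDiffAt
    exact (congrArg _ h).trans (smul_add _ _ _)
  map_smul' c φ := BoundedContinuousFunction.ext fun t => by
    have h : iteratedFDeriv ℝ (j : ℕ) ((c • φ : K1 n) : RSp n → ℂ) t = _ :=
      iteratedFDeriv_const_smul_apply (φ.contDiff.of_le (by exact_mod_cast le_top)).contDiffAt
    exact (congrArg _ h).trans (smul_comm _ _ _)

lemma eval_weightedDeriv (k : ℕ) (j : Fin (k + 1)) (φ : K1 n) (t : RSp n) :
    FormField.eval t (weightedDeriv k j φ) = Real.exp (k * ‖t‖) • iteratedFDeriv ℝ j φ t := rfl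

/-- The linear map `φ ↦ (e^{k|·|} φ^{(j)})_{j ≤ k}` into a Banach space, which carries the norm of
that space back to `ν_k`. -/
def jet (k : ℕ) : K1 n →ₗ[ℂ] ∀ j : Fin (k + 1), FormField n j :=
  LinearMap.pi (weightedDeriv k)

lemma norm_jet (k : ℕ) (φ : K1 n) : ‖jet k φ‖ = nu n k φ := by
  refine le_antisymm ((pi_norm_le_iff_of_nonneg (apply_nonneg _ _)).mpr fun j =>
    (BoundedContinuousFunction.norm_le (apply_nonneg _ _)).mpr
      (φ.norm_exp_smul_iteratedFDeriv_le (Nat.lt_succ_iff.mp j.2)))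
    (nu_le fun j hj t => ?_)
  let i : Fin (k + 1) := ⟨j, Nat.lt_succ_of_le hj⟩
  calc wder k φ j t = ‖FormField.eval t (weightedDeriv k i φ)‖ := by
        rw [eval_weightedDeriv, norm_smul, Real.norm_of_nonneg (Real.exp_pos _).le, wder]
    _ ≤ ‖weightedDeriv k i φ‖ := BoundedContinuousFunction.norm_coe_le_norm
        (weightedDeriv k i φ : BoundedContinuousFunction (RSp n) ((RSp n) [×j]→L[ℝ] ℂ)) t
    _ ≤ ‖jet k φ‖ := norm_le_pi_norm (jet k φ) i

lemma jet_injective (k : ℕ) : Function.Injective (jet (n := n) k) := by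
  refine (injective_iff_map_eq_zero _).mpr fun φ hφ => ext fun t => ?_
  have h := φ.norm_le k t
  rw [← norm_jet, hφ, norm_zero, zero_mul] at h
  exact norm_le_zero_iff.mp h

lemma continuous_jet (k : ℕ) : Continuous (jet (n := n) k) := by
  refine WithSeminorms.continuous_of_isBounded (τ₁₂ := RingHom.id ℂ) (withSeminorms n)
    (norm_withSeminorms ℂ _) (jet k) fun _ => ⟨{k}, 1, fun φ => ?_⟩
  rw [Finset.sup_singleton, one_smul]
  exact (norm_jet k φ).le

lemma exists_factor_jet (f : K1Dual n) : ∃ (k : ℕ)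
    (G : (∀ j : Fin (k + 1), FormField n j) →L[ℂ] ℂ), ∀ φ, f φ = G (jet k φ) := by
  obtain ⟨k, C, -, hf⟩ := exists_bound_of_continuous (withSeminorms n) nu_mono f
  let e := LinearEquiv.ofInjective (jet k) (jet_injective (n := n) k)
  have he : ∀ y, ‖(f.toLinearMap ∘ₗ e.symm.toLinearMap) y‖ ≤ C * ‖y‖ := by
    intro y
    obtain ⟨φ, rfl⟩ := e.surjective y
    have hnorm : ‖e φ‖ = nu n k φ := norm_jet k φ
    have hbound : ‖f φ‖ ≤ C * nu n k φ := hf φ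
    simpa [hnorm] using hbound
  obtain ⟨G, hG, -⟩ := exists_extension_norm_eq _ (LinearMap.mkContinuous _ C he)
  exact ⟨k, G, fun φ => by simpa [e] using (hG (e φ)).symm⟩

end Jet

section Integral

variable {P : Type*} [TopologicalSpace P] [MeasurableSpace P]

/-- A continuous family of test functions with `∫ ν_k(a_p) dμ(p) < ∞` for every `k`; such a family
has an integral in `𝒦₁(ℝⁿ)`. -/
structure IntegrableFamily (a : P → K1 n) (μ : Measure P) : Prop where
  continuous : Continuous a
  integrable_nu : ∀ k, Integrable (fun p => nu n k (a p)) μ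

variable [OpensMeasurableSpace P] {μ : Measure P} {a : P → K1 n}

lemma integrableFamily_of_le (ha : Continuous a)
    (hb : ∀ k, ∃ b : P → ℝ, Integrable b μ ∧ ∀ p, nu n k (a p) ≤ b p) : IntegrableFamily a μ where
  continuous := ha
  integrable_nu k := by
    obtain ⟨b, hb, hab⟩ := hb k
    refine hb.mono' (((withSeminorms n).continuous_seminorm k).comp ha).aestronglyMeasurable
      (.of_forall fun p => ?_)
    rw [Real.norm_of_nonneg (apply_nonneg _ _)]
    exact hab p

namespace IntegrableFamily

lemma integrable_comp (ha : IntegrableFamily a μ) (f : K1Dual n) :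
    Integrable (fun p => f (a p)) μ := by
  obtain ⟨k, C, -, hf⟩ := exists_bound_of_continuous (withSeminorms n) nu_mono f
  exact ((ha.integrable_nu k).const_mul C).mono'
    (f.continuous.comp ha.continuous).aestronglyMeasurable (.of_forall fun p => hf _)

variable [SecondCountableTopology P]

lemma integrable_jet (ha : IntegrableFamily a μ) (k : ℕ) :
    Integrable (fun p => jet k (a p)) μ :=
  (ha.integrable_nu k).mono' ((continuous_jet k).comp ha.continuous).aestronglyMeasurable
    (.of_forall fun p => (norm_jet k (a p)).le)

lemma eval_integral_jet (ha : IntegrableFamily a μ) (k : ℕ) (j : Fin (k + 1)) (t : RSp n) :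
    FormField.eval t ((∫ p, jet k (a p) ∂μ) j) =
      ∫ p, Real.exp (k * ‖t‖) • iteratedFDeriv ℝ j (a p) t ∂μ :=
  (((FormField.eval t).comp (ContinuousLinearMap.proj (R := ℂ)
    (φ := fun i : Fin (k + 1) => FormField n i) j)).integral_comp_comm (ha.integrable_jet k)).symm

lemma aestronglyMeasurable_iteratedFDeriv (ha : IntegrableFamily a μ) (j : ℕ) (t : RSp n) :
    AEStronglyMeasurable (fun p => iteratedFDeriv ℝ j (a p) t) μ := by
  have h := ((((FormField.eval t).comp (ContinuousLinearMap.proj (R := ℂ)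
    (φ := fun i : Fin (j + 1) => FormField n i) (Fin.last j))).integrable_comp
    (ha.integrable_jet j)).aestronglyMeasurable).const_smul (Real.exp (j * ‖t‖))⁻¹
  exact h.congr (.of_forall fun p => inv_smul_smul₀ (Real.exp_pos _).ne' _)

lemma integrable_apply (ha : IntegrableFamily a μ) (t : RSp n) : Integrable (fun p => a p t) μ := by
  refine (ha.integrable_nu 0).mono' ?_ (.of_forall fun p => by simpa using (a p).norm_le 0 t)
  exact (ContinuousMultilinearMap.apply ℝ (fun _ : Fin 0 => RSp n) ℂ
    ![]).continuous.comp_aestronglyMeasurable (ha.aestronglyMeasurable_iteratedFDeriv 0 t)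

lemma hasFTaylorSeriesUpTo (ha : IntegrableFamily a μ) :
    HasFTaylorSeriesUpTo ∞ (fun t => ∫ p, a p t ∂μ)
      (fun t j => ∫ p, iteratedFDeriv ℝ j (a p) t ∂μ) :=
  hasFTaylorSeriesUpTo_integral (fun p => (a p).contDiff) ha.aestronglyMeasurable_iteratedFDeriv
    ha.integrable_nu fun _ p t => (a p).norm_iteratedFDeriv_le_nu le_rfl t

lemma wder_integral_le (ha : IntegrableFamily a μ) {j k : ℕ} (hj : j ≤ k) (t : RSp n) :
    wder k (fun t => ∫ p, a p t ∂μ) j t ≤ ∫ p, nu n k (a p) ∂μ := by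
  rw [wder, ← ha.hasFTaylorSeriesUpTo.eq_iteratedFDeriv (by exact_mod_cast le_top) t,
    ← Real.norm_of_nonneg (Real.exp_pos _).le, ← norm_smul, ← integral_smul]
  refine norm_integral_le_of_norm_le (ha.integrable_nu k) (.of_forall fun p => ?_)
  rw [norm_smul, Real.norm_of_nonneg (Real.exp_pos _).le]
  exact (a p).wder_le_nu hj t

/-- The integral `∫ a_p dμ(p)` of a family of test functions. -/
def integral (ha : IntegrableFamily a μ) : K1 n :=
  ⟨fun t => ∫ p, a p t ∂μ, ha.hasFTaylorSeriesUpTo.contDiff, fun _ => ⟨_, fun _ hj =>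
    ha.wder_integral_le hj⟩⟩

lemma integral_apply (ha : IntegrableFamily a μ) (t : RSp n) : ha.integral t = ∫ p, a p t ∂μ := rfl

lemma nu_integral_le (ha : IntegrableFamily a μ) (k : ℕ) :
    nu n k ha.integral ≤ ∫ p, nu n k (a p) ∂μ :=
  nu_le fun _ hj => ha.wder_integral_le hj

/-- A functional bounded by `ν_k` extends, by the Hahn–Banach theorem, to the Banach space of
weighted jets, where it commutes with Bochner integrals. -/
lemma map_integral (ha : IntegrableFamily a μ) (f : K1Dual n) :
    f ha.integral = ∫ p, f (a p) ∂μ := by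
  obtain ⟨k, G, hG⟩ := exists_factor_jet f
  have hjet : jet k ha.integral = ∫ p, jet k (a p) ∂μ := by
    refine funext fun j => BoundedContinuousFunction.ext fun t => ?_
    change FormField.eval t (weightedDeriv k j ha.integral) = FormField.eval t _
    rw [ha.eval_integral_jet, integral_smul,
      ha.hasFTaylorSeriesUpTo.eq_iteratedFDeriv (by exact_mod_cast le_top) t]
    exact eval_weightedDeriv k j ha.integral t
  simp_rw [hG, hjet]
  exact (G.integral_comp_comm (ha.integrable_jet k)).symm

end IntegrableFamily

end Integral

end K1

/-! ### Polynomial decay and tubes -/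

/-- A polynomially decreasing integrable function on `ℝⁿ`. -/
def decay (t : RSp n) : ℝ := ((1 + ‖t‖) ^ (n + 1))⁻¹

lemma decay_nonneg (t : RSp n) : 0 ≤ decay t := by unfold decay; positivity

lemma integrable_decay : Integrable (decay : RSp n → ℝ) := by
  refine (integrable_one_add_norm (r := (n + 1 : ℕ)) (by simp)).congr (.of_forall fun t => ?_)
  simp only [decay]
  rw [Real.rpow_neg (by positivity), Real.rpow_natCast]

lemma integrable_decay_mul_decay :
    Integrable fun p : RSp n × RSp n => decay p.1 * decay p.2 :=
  integrable_decay.mul_prod integrable_decay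

lemma exp_mul_norm_le_decay_mul (k : ℕ) (t : RSp n) :
    Real.exp (k * ‖t‖) ≤ decay t * Real.exp ((k + (n + 1) : ℕ) * ‖t‖) := by
  have hpow : (1 + ‖t‖) ^ (n + 1) ≤ Real.exp ((n + 1 : ℕ) * ‖t‖) := by
    rw [Real.exp_nat_mul]
    exact pow_le_pow_left₀ (by positivity) (by linarith [Real.add_one_le_exp ‖t‖]) _
  rw [decay, inv_mul_eq_div, le_div_iff₀ (by positivity), Nat.cast_add, add_mul, Real.exp_add]
  gcongr

lemma norm_le_norm_cpt (ξ η : RSp n) : ‖ξ‖ ≤ ‖cpt ξ η‖ := by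
  rw [EuclideanSpace.norm_eq, EuclideanSpace.norm_eq]
  refine Real.sqrt_le_sqrt (Finset.sum_le_sum fun i _ => ?_)
  exact pow_le_pow_left₀ (norm_nonneg _) (by simpa [cpt] using Complex.abs_re_le_norm (cpt ξ η i)) 2

lemma one_add_norm_cpt_pow_le_decay_mul (k : ℕ) (ξ η : RSp n) :
    (1 + ‖cpt ξ η‖) ^ k ≤ decay ξ * (1 + ‖cpt ξ η‖) ^ (k + (n + 1)) := by
  rw [decay, inv_mul_eq_div, le_div_iff₀ (by positivity), pow_add _ k]
  gcongr
  exact norm_le_norm_cpt ξ η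

lemma exists_cpt_mem_tube (η : RSp n) : ∃ m : ℕ, ∀ ξ : RSp n, cpt ξ η ∈ tube n m := by
  obtain ⟨m, hm⟩ := exists_nat_ge ‖η‖
  refine ⟨m, fun ξ i => ?_⟩
  have him : (cpt ξ η i).im = η i := by simp [cpt]
  exact him ▸ (PiLp.norm_apply_le η i).trans hm

lemma continuous_cpt (η : RSp n) : Continuous fun ξ : RSp n => cpt ξ η := by
  unfold cpt
  fun_prop

lemma K1.exp_mul_norm_le (φ : K1 n) (k : ℕ) (t : RSp n) :
    Real.exp (k * ‖t‖) * ‖φ t‖ ≤ nu n (k + (n + 1)) φ * decay t := by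
  calc Real.exp (k * ‖t‖) * ‖φ t‖
      ≤ decay t * Real.exp ((k + (n + 1) : ℕ) * ‖t‖) * ‖φ t‖ := by
        gcongr; exact exp_mul_norm_le_decay_mul k t
    _ = decay t * wder (k + (n + 1)) φ 0 t := by rw [wder, norm_iteratedFDeriv_zero, mul_assoc]
    _ ≤ decay t * nu n (k + (n + 1)) φ := by
        gcongr
        · exact decay_nonneg t
        · exact φ.wder_le_nu (Nat.zero_le _) t
    _ = nu n (k + (n + 1)) φ * decay t := mul_comm _ _

lemma one_add_sq_rpow_half_eq (a : ℝ) (k : ℕ) :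
    (1 + a ^ 2) ^ ((k : ℝ) / 2) = √(1 + a ^ 2) ^ k := by
  rw [Real.sqrt_eq_rpow, ← Real.rpow_natCast (_ ^ (1 / 2 : ℝ)), ← Real.rpow_mul (by positivity)]
  congr 1
  ring

lemma one_add_pow_le_two_pow_mul {a : ℝ} (ha : 0 ≤ a) (k : ℕ) :
    (1 + a) ^ k ≤ 2 ^ k * (1 + a ^ 2) ^ ((k : ℝ) / 2) := by
  rw [one_add_sq_rpow_half_eq, ← mul_pow]
  gcongr
  exact abs_le_of_sq_le_sq' (by nlinarith [Real.sq_sqrt (show 0 ≤ 1 + a ^ 2 by positivity)])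
    (by positivity) |>.2

lemma one_add_sq_rpow_half_le {a : ℝ} (ha : 0 ≤ a) (k : ℕ) :
    (1 + a ^ 2) ^ ((k : ℝ) / 2) ≤ (1 + a) ^ k := by
  rw [one_add_sq_rpow_half_eq]
  gcongr
  exact Real.sqrt_le_iff.mpr ⟨by positivity, by nlinarith⟩

namespace KU

lemma exp_mul_pow_mul_norm_le (Φ : KU n) (x : RSp n) {k : ℕ} {z : CSp n} (hz : z ∈ tube n k) :
    Real.exp (k * ‖x‖) * (1 + ‖z‖) ^ k * ‖Φ x z‖ ≤ 2 ^ k * rho n k Φ := by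
  calc Real.exp (k * ‖x‖) * (1 + ‖z‖) ^ k * ‖Φ x z‖
      ≤ Real.exp (k * ‖x‖) * (2 ^ k * (1 + ‖z‖ ^ 2) ^ ((k : ℝ) / 2)) * ‖Φ x z‖ := by
        gcongr; exact one_add_pow_le_two_pow_mul (norm_nonneg z) k
    _ = 2 ^ k * wderU k Φ 0 x z := by rw [wderU, wder, norm_iteratedFDeriv_zero]; ring
    _ ≤ 2 ^ k * rho n k Φ := by gcongr; exact Φ.wderU_le_rho (Nat.zero_le k) x hz

lemma norm_fderiv_le_rho (Φ : KU n) {m : ℕ} {z : CSp n} (hz : z ∈ tube n m) (x : RSp n) :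
    ‖fderiv ℝ (fun x => Φ x z) x‖ ≤ rho n (m + 1) Φ := by
  rw [← norm_iteratedFDeriv_one]
  refine le_trans ?_ (Φ.wderU_le_rho (Nat.le_add_left 1 m) x (tube_mono m.le_succ hz))
  rw [wderU, wder, ← mul_assoc]
  exact le_mul_of_one_le_left (norm_nonneg _) (one_le_mul_of_one_le_of_one_le
    (Real.one_le_rpow (le_add_of_nonneg_right (sq_nonneg _)) (by positivity))
    (Real.one_le_exp (by positivity)))

lemma continuous_cpt (Φ : KU n) (η : RSp n) :
    Continuous fun p : RSp n × RSp n => Φ p.1 (cpt p.2 η) := by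
  obtain ⟨m, hm⟩ := exists_cpt_mem_tube η
  refine continuous_prod_of_continuous_lipschitzWith _ (Real.toNNReal (rho n (m + 1) Φ))
    (fun x => (Φ.2.2.1 x).continuous.comp (ExpSTFT.continuous_cpt η)) fun ξ => ?_
  refine lipschitzWith_of_nnnorm_fderiv_le (𝕜 := ℝ)
    ((Φ.2.1 (cpt ξ η)).differentiable (by simp)) fun x => ?_
  exact (Real.le_toNNReal_iff_coe_le (apply_nonneg _ _)).mpr (Φ.norm_fderiv_le_rho (hm ξ) x)

end KU

/-! ### Synthesis -/

lemma atom_apply (ψ : K1 n) (x : RSp n) (z : CSp n) (t : RSp n) :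
    atom ψ x z t = conj (ψ (t - x)) * cexpo z t := rfl

lemma atom_add (ψ χ : K1 n) (x : RSp n) (z : CSp n) :
    atom (ψ + χ) x z = atom ψ x z + atom χ x z :=
  K1.ext fun t => by simp only [atom_apply, K1.add_apply, map_add, add_mul]

lemma atom_smul (c : ℂ) (ψ : K1 n) (x : RSp n) (z : CSp n) :
    atom (c • ψ) x z = conj c • atom ψ x z :=
  K1.ext fun t => by simp only [atom_apply, K1.smul_apply, map_mul, mul_assoc]

lemma contDiff_cexpo_cpt {X : Type*} [NormedAddCommGroup X] [NormedSpace ℝ X] {u v : X → RSp n}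
    (hu : ContDiff ℝ ∞ u) (hv : ContDiff ℝ ∞ v) (η : RSp n) :
    ContDiff ℝ ∞ fun q => cexpo (cpt (u q) η) (v q) := by
  have hcoord {w : X → RSp n} (hw : ContDiff ℝ ∞ w) (i) : ContDiff ℝ ∞ fun q => (w q i : ℂ) :=
    Complex.ofRealCLM.contDiff.comp
      ((EuclideanSpace.proj i : RSp n →L[ℝ] ℝ).contDiff.comp hw)
  unfold cexpo cdot
  exact Complex.contDiff_exp.comp (contDiff_const.mul (ContDiff.sum fun i _ =>
    ((hcoord hu i).add contDiff_const).mul (hcoord hv i)))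

lemma continuous_atom (ψ : K1 n) (η : RSp n) :
    Continuous fun p : RSp n × RSp n => atom ψ p.1 (cpt p.2 η) := by
  obtain ⟨m, hm⟩ := exists_cpt_mem_tube η
  refine K1.continuous_of_contDiff ?_ fun k => ⟨_, ?_, fun p => nu_atom_le ψ p.1 (hm p.2)⟩
  · exact (ψ.conjugate.contDiff.comp (contDiff_snd.sub contDiff_fst.fst)).mul
      (contDiff_cexpo_cpt contDiff_fst.snd contDiff_snd η)
  · have hcpt := (continuous_cpt η).comp (continuous_snd (X := RSp n))
    fun_prop

lemma nu_smul_atom_le (Φ : KU n) (ψ : K1 n) (x ξ η : RSp n) (k : ℕ) {m : ℕ}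
    (hm : cpt ξ η ∈ tube n m) {N : ℕ} (hN : N = k + expRate n m + m + (n + 1)) :
    K1.nu n k (Φ x (cpt ξ η) • atom ψ x (cpt ξ η)) ≤
      (4 * Real.pi) ^ k * 2 ^ N * (K1.nu n N ψ * KU.rho n N Φ) * (decay x * decay ξ) := by
  have hexp : Real.exp ((k + expRate n m) * ‖x‖) ≤ decay x * Real.exp (N * ‖x‖) := by
    rw [hN]
    refine le_trans (Real.exp_le_exp.mpr ?_)
      (exp_mul_norm_le_decay_mul (k + expRate n m + m) x)
    push_cast
    exact mul_le_mul_of_nonneg_right (le_add_of_nonneg_right (Nat.cast_nonneg m)) (norm_nonneg x)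
  have hpow : (1 + ‖cpt ξ η‖) ^ k ≤ decay ξ * (1 + ‖cpt ξ η‖) ^ N := by
    rw [hN]
    refine le_trans ?_ (one_add_norm_cpt_pow_le_decay_mul (k + expRate n m + m) ξ η)
    exact pow_le_pow_right₀ (le_add_of_nonneg_right (norm_nonneg _)) (by omega)
  have hψ : K1.nu n (k + expRate n m) ψ ≤ K1.nu n N ψ := K1.nu_mono (by omega) ψ
  have hdx := decay_nonneg x
  have hdξ := decay_nonneg ξ
  rw [map_smul_eq_mul]
  calc ‖Φ x (cpt ξ η)‖ * K1.nu n k (atom ψ x (cpt ξ η))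
      ≤ ‖Φ x (cpt ξ η)‖ * ((4 * Real.pi) ^ k * K1.nu n N ψ *
          (decay x * Real.exp (N * ‖x‖) * (decay ξ * (1 + ‖cpt ξ η‖) ^ N))) := by
        gcongr
        exact (nu_atom_le ψ x hm).trans (by gcongr)
    _ = (4 * Real.pi) ^ k * K1.nu n N ψ * (decay x * decay ξ) *
          (Real.exp (N * ‖x‖) * (1 + ‖cpt ξ η‖) ^ N * ‖Φ x (cpt ξ η)‖) := by ring
    _ ≤ (4 * Real.pi) ^ k * K1.nu n N ψ * (decay x * decay ξ) * (2 ^ N * KU.rho n N Φ) :=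
        mul_le_mul_of_nonneg_left
          (Φ.exp_mul_pow_mul_norm_le x (KU.tube_mono (show m ≤ N by omega) hm)) (by positivity)
    _ = _ := by ring

lemma exists_nu_smul_atom_le (η : RSp n) (k : ℕ) : ∃ (N : ℕ) (C : ℝ), 0 ≤ C ∧
    ∀ (ψ : K1 n) (Φ : KU n) (p : RSp n × RSp n),
      K1.nu n k (Φ p.1 (cpt p.2 η) • atom ψ p.1 (cpt p.2 η)) ≤
        C * (K1.nu n N ψ * KU.rho n N Φ) * (decay p.1 * decay p.2) := by
  obtain ⟨m, hm⟩ := exists_cpt_mem_tube η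
  exact ⟨_, _, by positivity, fun ψ Φ p => nu_smul_atom_le Φ ψ p.1 p.2 η k (hm p.2) rfl⟩

lemma integrableFamily_smul_atom (η : RSp n) (ψ : K1 n) (Φ : KU n) :
    K1.IntegrableFamily (fun p : RSp n × RSp n => Φ p.1 (cpt p.2 η) • atom ψ p.1 (cpt p.2 η))
      volume :=
  K1.integrableFamily_of_le ((Φ.continuous_cpt η).smul (continuous_atom ψ η)) fun k =>
    let ⟨_, _, _, h⟩ := exists_nu_smul_atom_le η k
    ⟨_, integrable_decay_mul_decay.const_mul _, h ψ Φ⟩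

/-- The synthesis map
`(ψ, Φ) ↦ ∬ Φ(x, ξ + iη) conj(ψ(· - x)) e^{-2πi (ξ + iη) · (·)} dx dξ`, with values in `𝒦₁(ℝⁿ)`.
The STFT of distributions is its transpose at `η = 0`. -/
def synthesis (η : RSp n) : K1 n →ₗ⋆[ℂ] KU n →ₗ[ℂ] K1 n :=
  LinearMap.mk₂'ₛₗ (starRingEnd ℂ) (RingHom.id ℂ)
    (fun ψ Φ => (integrableFamily_smul_atom η ψ Φ).integral)
    (fun ψ χ Φ => K1.ext fun t => by
      simp only [K1.IntegrableFamily.integral_apply, K1.add_apply, atom_add, smul_add]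
      exact integral_add ((integrableFamily_smul_atom η ψ Φ).integrable_apply t)
        ((integrableFamily_smul_atom η χ Φ).integrable_apply t))
    (fun c ψ Φ => K1.ext fun t => by
      simp only [K1.IntegrableFamily.integral_apply, K1.smul_apply, atom_smul,
        smul_comm _ (conj c)]
      exact integral_const_mul _ _)
    (fun ψ Φ Θ => K1.ext fun t => by
      simp only [K1.IntegrableFamily.integral_apply, K1.add_apply, KU.add_apply, add_smul]
      exact integral_add ((integrableFamily_smul_atom η ψ Φ).integrable_apply t)
        ((integrableFamily_smul_atom η ψ Θ).integrable_apply t))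
    (fun c ψ Φ => K1.ext fun t => by
      simp only [K1.IntegrableFamily.integral_apply, K1.smul_apply, KU.smul_apply, mul_assoc]
      exact integral_const_mul _ _)

lemma synthesis_apply (η : RSp n) (ψ : K1 n) (Φ : KU n) (t : RSp n) : synthesis η ψ Φ t =
    ∫ p : RSp n × RSp n, Φ p.1 (cpt p.2 η) * (conj (ψ (t - p.1)) * cexpo (cpt p.2 η) t) := rfl

lemma isBoundedBilin_synthesis (η : RSp n) :
    IsBoundedBilin (KU.rhoFamily n) (K1.nuFamily n) (K1.nuFamily n) fun ψ Φ => synthesis η ψ Φ := by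
  intro k
  obtain ⟨N, C, hC, h⟩ := exists_nu_smul_atom_le η k
  have hI : 0 ≤ ∫ p : RSp n × RSp n, decay p.1 * decay p.2 :=
    integral_nonneg fun p => mul_nonneg (decay_nonneg _) (decay_nonneg _)
  refine ⟨N, C * ∫ p : RSp n × RSp n, decay p.1 * decay p.2, by positivity, fun ψ Φ => ?_⟩
  have hfam := integrableFamily_smul_atom η ψ Φ
  calc K1.nu n k (synthesis η ψ Φ)
      ≤ ∫ p : RSp n × RSp n, K1.nu n k (Φ p.1 (cpt p.2 η) • atom ψ p.1 (cpt p.2 η)) :=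
        hfam.nu_integral_le k
    _ ≤ ∫ p : RSp n × RSp n, C * (K1.nu n N ψ * KU.rho n N Φ) * (decay p.1 * decay p.2) :=
        integral_mono (hfam.integrable_nu k) (integrable_decay_mul_decay.const_mul _) (h ψ Φ)
    _ = (C * ∫ p : RSp n × RSp n, decay p.1 * decay p.2) * (K1.nu n N ψ * KU.rho n N Φ) := by
        rw [integral_const_mul, mul_right_comm]

lemma map_smul_atom (f : K1Dual n) (ψ : K1 n) (x : RSp n) (z : CSp n) (c : ℂ) :
    f (c • atom ψ x z) = stftDist f ψ x z * c := by
  rw [map_smul, smul_eq_mul, mul_comm, stftDist]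

lemma integrable_stftDist_mul (f : K1Dual n) (ψ : K1 n) (Φ : KU n) (η : RSp n) :
    Integrable fun p : RSp n × RSp n => stftDist f ψ p.1 (cpt p.2 η) * Φ p.1 (cpt p.2 η) := by
  simp only [← map_smul_atom]
  exact (integrableFamily_smul_atom η ψ Φ).integrable_comp f

lemma map_synthesis (f : K1Dual n) (ψ : K1 n) (Φ : KU n) (η : RSp n) : f (synthesis η ψ Φ) =
    ∫ p : RSp n × RSp n, stftDist f ψ p.1 (cpt p.2 η) * Φ p.1 (cpt p.2 η) := by
  simp only [← map_smul_atom]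
  exact (integrableFamily_smul_atom η ψ Φ).map_integral f

/-! ### Analysis -/

namespace K1

lemma integrable (φ : K1 n) : Integrable φ :=
  (integrable_decay.const_mul (nu n (0 + (n + 1)) φ)).mono' φ.continuous.aestronglyMeasurable
    (.of_forall fun t => by simpa using φ.exp_mul_norm_le 0 t)

lemma norm_le_nu (φ : K1 n) (t : RSp n) : ‖φ t‖ ≤ nu n 0 φ := by
  simpa using φ.norm_le 0 t

lemma integrable_mul (φ χ : K1 n) : Integrable fun t => φ t * χ t :=
  φ.integrable.mul_bdd (c := nu n 0 χ) χ.continuous.aestronglyMeasurable (.of_forall χ.norm_le_nu)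

lemma integral_mul_dirDeriv (φ χ : K1 n) (v : RSp n) :
    ∫ t, φ t * dirDeriv v χ t = -∫ t, dirDeriv v φ t * χ t :=
  integral_mul_fderiv_eq_neg_fderiv_mul_of_integrable ((dirDeriv v φ).integrable_mul χ)
    (φ.integrable_mul (dirDeriv v χ)) (φ.integrable_mul χ)
    (fun t _ => φ.contDiff.differentiable (by simp) t)
    (fun t _ => χ.contDiff.differentiable (by simp) t)

lemma continuous_constSub (φ : K1 n) : Continuous φ.constSub :=
  continuous_of_contDiff (φ.contDiff.comp (contDiff_fst.sub contDiff_snd)) fun k =>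
    ⟨fun t => Real.exp (k * ‖t‖) * nu n k φ, by fun_prop, nu_constSub_le k φ⟩

end K1

lemma exists_mem_tube (z : CSp n) : ∃ m : ℕ, ∀ w ∈ Metric.closedBall z 1, w ∈ tube n m := by
  obtain ⟨m, hm⟩ := exists_nat_ge (‖z‖ + 1)
  refine ⟨m, fun w hw i => ?_⟩
  calc |(w i).im| ≤ ‖w i‖ := Complex.abs_im_le_norm _
    _ ≤ ‖w‖ := PiLp.norm_apply_le w i
    _ ≤ ‖z‖ + 1 := norm_le_of_mem_closedBall hw
    _ ≤ m := hm

lemma neg_mem_tube {z : CSp n} {m : ℕ} (hz : z ∈ tube n m) : -z ∈ tube n m := fun i => by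
  simpa using hz i

lemma nu_smul_constSub_le (ψ φ : K1 n) (k : ℕ) {m : ℕ} {z : CSp n} (hz : z ∈ tube n m)
    (t : RSp n) : K1.nu n k ((φ t * cexpo z t) • ψ.conjugate.constSub t) ≤
      K1.nu n (k + expRate n m + (n + 1)) ψ * K1.nu n (k + expRate n m + (n + 1)) φ * decay t := by
  have hφ := φ.exp_mul_norm_le (k + expRate n m) t
  rw [Nat.cast_add, add_mul, Real.exp_add] at hφ
  have hψ : K1.nu n k ψ.conjugate ≤ K1.nu n (k + expRate n m + (n + 1)) ψ :=
    (K1.nu_conjugate_le k ψ).trans (K1.nu_mono (by omega) ψ)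
  rw [map_smul_eq_mul, norm_mul]
  calc ‖φ t‖ * ‖cexpo z t‖ * K1.nu n k (ψ.conjugate.constSub t)
      ≤ ‖φ t‖ * Real.exp (expRate n m * ‖t‖) * (Real.exp (k * ‖t‖) * K1.nu n k ψ.conjugate) := by
        gcongr
        · exact norm_cexpo_le hz t
        · exact ψ.conjugate.nu_constSub_le k t
    _ = Real.exp (k * ‖t‖) * Real.exp (expRate n m * ‖t‖) * ‖φ t‖ * K1.nu n k ψ.conjugate := by
        ring
    _ ≤ K1.nu n (k + expRate n m + (n + 1)) φ * decay t *
          K1.nu n (k + expRate n m + (n + 1)) ψ :=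
        mul_le_mul hφ hψ (apply_nonneg _ _) (mul_nonneg (apply_nonneg _ _) (decay_nonneg t))
    _ = _ := by ring

lemma integrableFamily_smul_constSub (z : CSp n) (ψ φ : K1 n) :
    K1.IntegrableFamily (fun t => (φ t * cexpo z t) • ψ.conjugate.constSub t) volume := by
  obtain ⟨m, hm⟩ := exists_mem_tube z
  have hz := hm z (Metric.mem_closedBall_self zero_le_one)
  exact K1.integrableFamily_of_le ((φ.continuous.mul (contDiff_cexpo z).continuous).smul
    ψ.conjugate.continuous_constSub) fun k =>
      ⟨_, integrable_decay.const_mul _, nu_smul_constSub_le ψ φ k hz⟩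

/-- The STFT of a test function at a fixed frequency, `x ↦ V_ψ φ(x, z)`, as a test function. -/
def stftAt (z : CSp n) (ψ φ : K1 n) : K1 n := (integrableFamily_smul_constSub z ψ φ).integral

lemma stftAt_apply (z : CSp n) (ψ φ : K1 n) (x : RSp n) : stftAt z ψ φ x = stftFun φ ψ x z := by
  simp only [stftAt, K1.IntegrableFamily.integral_apply, K1.smul_apply, K1.constSub_apply,
    K1.conjugate_apply, stftFun, mul_assoc, mul_comm (cexpo z _)]

lemma stftFun_eq_integral_mul_atom (φ ψ : K1 n) (x : RSp n) (z : CSp n) :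
    stftFun φ ψ x z = ∫ t, φ t * atom ψ x z t := rfl

lemma nu_stftAt_le (ψ φ : K1 n) (k : ℕ) {m : ℕ} {z : CSp n} (hz : z ∈ tube n m) :
    K1.nu n k (stftAt z ψ φ) ≤ (∫ t : RSp n, decay t) *
      (K1.nu n (k + expRate n m + (n + 1)) ψ * K1.nu n (k + expRate n m + (n + 1)) φ) := by
  have hfam := integrableFamily_smul_constSub z ψ φ
  refine (hfam.nu_integral_le k).trans ((integral_mono (hfam.integrable_nu k)
    (integrable_decay.const_mul _) (nu_smul_constSub_le ψ φ k hz)).trans_eq ?_)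
  rw [integral_const_mul, mul_comm]

lemma dirDeriv_atom (v : RSp n) (ψ : K1 n) (x : RSp n) (z : CSp n) :
    K1.dirDeriv v (atom ψ x z) = atom (K1.dirDeriv v ψ) x z + expoForm z v • atom ψ x z := by
  refine K1.ext fun t => ?_
  have hψ : HasFDerivAt (fun t => conj (ψ (t - x)))
      ((Complex.conjCLE : ℂ →L[ℝ] ℂ) ∘L fderiv ℝ ψ (t - x)) t :=
    (Complex.conjCLE : ℂ →L[ℝ] ℂ).hasFDerivAt.comp t
      ((hasFDerivAt_comp_sub x).mpr (ψ.contDiff.differentiable (by simp) (t - x)).hasFDerivAt)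
  have h : fderiv ℝ (atom ψ x z) t = _ := (hψ.mul (hasFDerivAt_cexpo z t)).fderiv
  simp only [K1.dirDeriv_apply, K1.add_apply, K1.smul_apply, atom_apply, h]
  simp only [_root_.add_apply, _root_.smul_apply, smul_eq_mul, ContinuousLinearMap.comp_apply,
    ContinuousLinearEquiv.coe_coe, ContinuousAlgEquiv.coeCLE_apply, Complex.conjCAE_apply]
  ring

lemma expoForm_smul_stftAt (z : CSp n) (ψ φ : K1 n) (v : RSp n) :
    expoForm z v • stftAt z ψ φ =
      -(stftAt z ψ (K1.dirDeriv v φ) + stftAt z (K1.dirDeriv v ψ) φ) := by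
  rw [eq_neg_iff_add_eq_zero]
  refine K1.ext fun x => ?_
  have hparts := φ.integral_mul_dirDeriv (atom ψ x z) v
  have hsplit : ∫ t, φ t * K1.dirDeriv v (atom ψ x z) t =
      (∫ t, φ t * atom (K1.dirDeriv v ψ) x z t) + expoForm z v * ∫ t, φ t * atom ψ x z t := by
    rw [← integral_const_mul, ← integral_add (φ.integrable_mul _)
      ((φ.integrable_mul _).const_mul _)]
    simp only [dirDeriv_atom, K1.add_apply, K1.smul_apply, mul_add, mul_left_comm (φ _)]
  simp only [K1.add_apply, K1.smul_apply, stftAt_apply, stftFun_eq_integral_mul_atom]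
  change _ = (0 : ℂ)
  linear_combination hparts - hsplit

lemma norm_coord_mul_nu_stftAt_le (z : CSp n) (ψ φ : K1 n) (k : ℕ) (i : Fin n) :
    ‖z i‖ * K1.nu n k (stftAt z ψ φ) ≤
      K1.nu n k (stftAt z ψ (K1.dirDeriv (EuclideanSpace.single i 1) φ)) +
        K1.nu n k (stftAt z (K1.dirDeriv (EuclideanSpace.single i 1) ψ) φ) := by
  have hcoord : ‖z i‖ ≤ ‖expoForm z (EuclideanSpace.single i 1)‖ := by
    have : cdot z (EuclideanSpace.single i 1) = z i := by
      simp [cdot, apply_ite]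
    rw [expoForm_apply, this, norm_mul]
    refine le_mul_of_one_le_left (norm_nonneg _) ?_
    calc (1 : ℝ) ≤ 2 * Real.pi := by linarith [Real.pi_gt_three]
      _ = ‖(-2 * Real.pi * Complex.I : ℂ)‖ := by simp [abs_of_nonneg Real.pi_pos.le]
  calc ‖z i‖ * K1.nu n k (stftAt z ψ φ)
      ≤ ‖expoForm z (EuclideanSpace.single i 1)‖ * K1.nu n k (stftAt z ψ φ) := by gcongr
    _ = K1.nu n k (stftAt z ψ (K1.dirDeriv (EuclideanSpace.single i 1) φ) +
          stftAt z (K1.dirDeriv (EuclideanSpace.single i 1) ψ) φ) := by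
        rw [← map_smul_eq_mul, expoForm_smul_stftAt, map_neg_eq_map]
    _ ≤ _ := map_add_le_add _ _ _

lemma norm_le_sum_norm_coord {ι : Type*} [Fintype ι] (z : EuclideanSpace ℂ ι) :
    ‖z‖ ≤ ∑ i, ‖z i‖ := by
  rw [EuclideanSpace.norm_eq]
  exact Real.sqrt_le_iff.mpr ⟨Finset.sum_nonneg fun _ _ => norm_nonneg _,
    Finset.sum_sq_le_sq_sum_of_nonneg fun _ _ => norm_nonneg _⟩

lemma one_add_norm_mul_nu_stftAt_le (z : CSp n) (ψ φ : K1 n) (k : ℕ) :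
    (1 + ‖z‖) * K1.nu n k (stftAt z ψ φ) ≤ K1.nu n k (stftAt z ψ φ) + ∑ i,
      (K1.nu n k (stftAt z ψ (K1.dirDeriv (EuclideanSpace.single i 1) φ)) +
        K1.nu n k (stftAt z (K1.dirDeriv (EuclideanSpace.single i 1) ψ) φ)) := by
  calc (1 + ‖z‖) * K1.nu n k (stftAt z ψ φ)
      ≤ (1 + ∑ i, ‖z i‖) * K1.nu n k (stftAt z ψ φ) := by
        gcongr; exact norm_le_sum_norm_coord z
    _ = K1.nu n k (stftAt z ψ φ) + ∑ i, ‖z i‖ * K1.nu n k (stftAt z ψ φ) := by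
        rw [add_mul, one_mul, Finset.sum_mul]
    _ ≤ _ := by gcongr with i; exact norm_coord_mul_nu_stftAt_le z ψ φ k i

/-- Each power of `1 + |z|` is traded for derivatives of `φ` and `ψ` by integration by parts. -/
lemma one_add_norm_pow_mul_nu_stftAt_le (k p : ℕ) {m : ℕ} {z : CSp n} (hz : z ∈ tube n m)
    (ψ φ : K1 n) : (1 + ‖z‖) ^ p * K1.nu n k (stftAt z ψ φ) ≤
      (1 + 2 * n) ^ p * (∫ t : RSp n, decay t) *
        (K1.nu n (k + expRate n m + (n + 1) + p) ψ *
          K1.nu n (k + expRate n m + (n + 1) + p) φ) := by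
  induction p generalizing ψ φ with
  | zero => simpa using nu_stftAt_le ψ φ k hz
  | succ p ih =>
    rw [← add_assoc]
    set N := k + expRate n m + (n + 1) + p
    have hI : 0 ≤ ∫ t : RSp n, decay t := integral_nonneg decay_nonneg
    set B := (1 + 2 * (n : ℝ)) ^ p * (∫ t : RSp n, decay t) *
      (K1.nu n (N + 1) ψ * K1.nu n (N + 1) φ) with hB
    have hN (χ : K1 n) : K1.nu n N χ ≤ K1.nu n (N + 1) χ := K1.nu_mono N.le_succ χ
    have hderiv (i : Fin n) (χ : K1 n) :
        K1.nu n N (K1.dirDeriv (EuclideanSpace.single i 1) χ) ≤ K1.nu n (N + 1) χ := by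
      simpa using K1.nu_dirDeriv_le N (EuclideanSpace.single i 1) χ
    have hterm (χ₁ χ₂ : K1 n) (hχ₁ : K1.nu n N χ₁ ≤ K1.nu n (N + 1) ψ)
        (hχ₂ : K1.nu n N χ₂ ≤ K1.nu n (N + 1) φ) :
        (1 + ‖z‖) ^ p * K1.nu n k (stftAt z χ₁ χ₂) ≤ B :=
      (ih χ₁ χ₂).trans (mul_le_mul_of_nonneg_left (mul_le_mul hχ₁ hχ₂ (apply_nonneg _ _)
        (apply_nonneg _ _)) (by positivity))
    calc (1 + ‖z‖) ^ (p + 1) * K1.nu n k (stftAt z ψ φ)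
        = (1 + ‖z‖) ^ p * ((1 + ‖z‖) * K1.nu n k (stftAt z ψ φ)) := by rw [pow_succ, mul_assoc]
      _ ≤ (1 + ‖z‖) ^ p * (K1.nu n k (stftAt z ψ φ) + ∑ i,
            (K1.nu n k (stftAt z ψ (K1.dirDeriv (EuclideanSpace.single i 1) φ)) +
              K1.nu n k (stftAt z (K1.dirDeriv (EuclideanSpace.single i 1) ψ) φ))) := by
          gcongr; exact one_add_norm_mul_nu_stftAt_le z ψ φ k
      _ ≤ B + ∑ _i : Fin n, (B + B) := by
          simp only [mul_add ((1 + ‖z‖) ^ p), Finset.mul_sum]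
          exact add_le_add (hterm ψ φ (hN ψ) (hN φ)) (Finset.sum_le_sum fun i _ =>
            add_le_add (hterm _ _ (hN ψ) (hderiv i φ)) (hterm _ _ (hderiv i ψ) (hN φ)))
      _ = _ := by
          rw [Finset.sum_const, Finset.card_univ, Fintype.card_fin, nsmul_eq_mul, hB]
          ring

/-! ### Holomorphy -/

/-- The complex-linear form `z ↦ -2πi z·t`. -/
def freqForm (t : RSp n) : CSp n →L[ℂ] ℂ :=
  ∑ i, (-2 * Real.pi * Complex.I * (t i : ℂ)) • (EuclideanSpace.proj i : CSp n →L[ℂ] ℂ)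

lemma freqForm_apply (t : RSp n) (z : CSp n) :
    freqForm t z = -2 * Real.pi * Complex.I * cdot z t := by
  simp only [cdot, freqForm, Finset.mul_sum, _root_.sum_apply, _root_.smul_apply,
    PiLp.proj_apply, smul_eq_mul]
  exact Finset.sum_congr rfl fun i _ => by ring

lemma continuous_freqForm : Continuous (freqForm : RSp n → CSp n →L[ℂ] ℂ) := by
  unfold freqForm
  fun_prop

lemma norm_freqForm_le (t : RSp n) : ‖freqForm t‖ ≤ 2 * Real.pi * ‖t‖ := by
  refine ContinuousLinearMap.opNorm_le_bound _ (by positivity) fun z => ?_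
  rw [freqForm_apply, ← expoForm_apply]
  calc ‖expoForm z t‖ ≤ 2 * Real.pi * ‖z‖ * ‖t‖ :=
        (expoForm z).le_of_opNorm_le (norm_expoForm_le z) t
    _ = 2 * Real.pi * ‖t‖ * ‖z‖ := mul_right_comm _ _ _

lemma hasFDerivAt_cexpo_left (t : RSp n) (z : CSp n) :
    HasFDerivAt (fun z => cexpo z t) (cexpo z t • freqForm t) z := by
  have h := (freqForm t).hasFDerivAt (x := z) |>.cexp
  simp only [freqForm_apply] at h
  exact h

lemma norm_cexpo_smul_freqForm_le {m : ℕ} {z : CSp n} (hz : z ∈ tube n m) (t : RSp n) :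
    ‖cexpo z t • freqForm t‖ ≤ 2 * Real.pi * Real.exp ((expRate n m + 1 : ℕ) * ‖t‖) := by
  have ht : ‖t‖ ≤ Real.exp ‖t‖ := by linarith [Real.add_one_le_exp ‖t‖]
  calc ‖cexpo z t • freqForm t‖
      ≤ Real.exp (expRate n m * ‖t‖) * (2 * Real.pi * Real.exp ‖t‖) := by
        rw [norm_smul]
        exact mul_le_mul (norm_cexpo_le hz t) ((norm_freqForm_le t).trans (by gcongr))
          (norm_nonneg _) (Real.exp_pos _).le
    _ = 2 * Real.pi * Real.exp ((expRate n m + 1 : ℕ) * ‖t‖) := by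
        rw [Nat.cast_add_one, add_mul, one_mul, Real.exp_add]; ring

lemma differentiable_integral_mul_cexpo {h : RSp n → ℂ} (hh : Continuous h)
    (hexp : ∀ k : ℕ, Integrable fun t => Real.exp (k * ‖t‖) * ‖h t‖) :
    Differentiable ℂ fun z => ∫ t, h t * cexpo z t := by
  intro z₀
  obtain ⟨m, hm⟩ := exists_mem_tube z₀
  have hcont (z : CSp n) : Continuous fun t => h t * cexpo z t :=
    hh.mul (contDiff_cexpo z).continuous
  have hcont' : Continuous fun t => h t • cexpo z₀ t • freqForm t :=
    hh.smul ((contDiff_cexpo z₀).continuous.smul continuous_freqForm)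
  have hint : Integrable fun t => h t * cexpo z₀ t :=
    (hexp (expRate n m)).mono' (hcont z₀).aestronglyMeasurable (.of_forall fun t => by
      rw [norm_mul, mul_comm]
      gcongr
      exact norm_cexpo_le (hm z₀ (Metric.mem_closedBall_self zero_le_one)) t)
  refine (hasFDerivAt_integral_of_dominated_of_fderiv_le (𝕜 := ℂ)
    (F' := fun z t => h t • cexpo z t • freqForm t)
    (bound := fun t => 2 * Real.pi * (Real.exp ((expRate n m + 1 : ℕ) * ‖t‖) * ‖h t‖))
    (Metric.closedBall_mem_nhds z₀ one_pos) (.of_forall fun z => (hcont z).aestronglyMeasurable)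
    hint hcont'.aestronglyMeasurable (.of_forall fun t z hz => ?_)
    ((hexp _).const_mul _) (.of_forall fun t z _ => ?_)).differentiableAt
  · rw [norm_smul, mul_comm, ← mul_assoc]
    gcongr
    exact norm_cexpo_smul_freqForm_le (hm z hz) t
  · exact (hasFDerivAt_cexpo_left t z).const_mul (h t)

lemma differentiable_stftFun (φ ψ : K1 n) (x : RSp n) : Differentiable ℂ (stftFun φ ψ x) := by
  have hcont : Continuous fun t => φ t * conj (ψ (t - x)) :=
    φ.continuous.mul (ψ.conjugate.continuous.comp (continuous_id.sub continuous_const))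
  have h := differentiable_integral_mul_cexpo hcont fun k => by
    refine ((integrable_decay.const_mul (K1.nu n (k + (n + 1)) φ)).mul_const
      (K1.nu n 0 ψ)).mono' (by fun_prop) (.of_forall fun t => ?_)
    rw [norm_mul, norm_norm, norm_mul, RCLike.norm_conj, Real.norm_of_nonneg (Real.exp_pos _).le,
      ← mul_assoc]
    exact mul_le_mul (φ.exp_mul_norm_le k t) (ψ.norm_le_nu _) (norm_nonneg _)
      (mul_nonneg (apply_nonneg _ _) (decay_nonneg t))
  simp only [mul_assoc] at h
  exact h

/-! ### The adjoint STFT -/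

lemma wderU_stftFun_neg_le (ψ φ : K1 n) {j k : ℕ} (hj : j ≤ k) (x : RSp n) {z : CSp n}
    (hz : z ∈ tube n k) : wderU k (fun x z => stftFun φ ψ x (-z)) j x z ≤
      (1 + 2 * n) ^ k * (∫ t : RSp n, decay t) *
        (K1.nu n (k + expRate n k + (n + 1) + k) ψ *
          K1.nu n (k + expRate n k + (n + 1) + k) φ) := by
  have hslice : (fun x => stftFun φ ψ x (-z)) = stftAt (-z) ψ φ :=
    funext fun x => (stftAt_apply (-z) ψ φ x).symm
  calc wderU k (fun x z => stftFun φ ψ x (-z)) j x z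
      ≤ (1 + ‖-z‖) ^ k * K1.nu n k (stftAt (-z) ψ φ) := by
        rw [wderU, hslice, norm_neg]
        gcongr
        · unfold wder; positivity
        · exact one_add_sq_rpow_half_le (norm_nonneg z) k
        · exact (stftAt (-z) ψ φ).wder_le_nu hj x
    _ ≤ _ := one_add_norm_pow_mul_nu_stftAt_le k k (neg_mem_tube hz) ψ φ

/-- The element `(x, z) ↦ V_ψ φ(x, -z)` of `𝒦₁(ℝⁿ) ⊗̂ 𝒰(ℂⁿ)`. -/
def stftNeg (ψ φ : K1 n) : KU n :=
  ⟨fun x z => stftFun φ ψ x (-z),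
    fun z => funext (stftAt_apply (-z) ψ φ) ▸ (stftAt (-z) ψ φ).contDiff,
    fun x => (differentiable_stftFun φ ψ x).comp differentiable_fun_id.neg,
    fun _ => ⟨_, fun _ hj x _ hz => wderU_stftFun_neg_le ψ φ hj x hz⟩⟩

lemma rho_stftNeg_le (ψ φ : K1 n) (k : ℕ) : KU.rho n k (stftNeg ψ φ) ≤
    (1 + 2 * n) ^ k * (∫ t : RSp n, decay t) *
      (K1.nu n (k + expRate n k + (n + 1) + k) ψ *
        K1.nu n (k + expRate n k + (n + 1) + k) φ) :=
  KU.rho_le fun _ hj x _ hz => wderU_stftFun_neg_le ψ φ hj x hz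

/-- The analysis map `(ψ, φ) ↦ ((x, z) ↦ ∫ φ(t) ψ(t - x) e^{2πi z·t} dt)`, with values in
`𝒦₁(ℝⁿ) ⊗̂ 𝒰(ℂⁿ)`. The adjoint STFT is its transpose. -/
def analysis (n : ℕ) : K1 n →ₗ[ℂ] K1 n →ₗ[ℂ] KU n :=
  LinearMap.mk₂ ℂ (fun ψ φ => stftNeg ψ.conjugate φ)
    (fun ψ χ φ => KU.ext fun x z => by
      change ∫ t, φ t * atom (ψ + χ).conjugate x (-z) t =
        (∫ t, φ t * atom ψ.conjugate x (-z) t) + ∫ t, φ t * atom χ.conjugate x (-z) t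
      rw [← integral_add (φ.integrable_mul _) (φ.integrable_mul _)]
      simp only [atom_apply, K1.conjugate_apply, K1.add_apply, map_add, add_mul, mul_add])
    (fun c ψ φ => KU.ext fun x z => by
      change ∫ t, φ t * atom (c • ψ).conjugate x (-z) t =
        c * ∫ t, φ t * atom ψ.conjugate x (-z) t
      rw [← integral_const_mul]
      simp only [atom_apply, K1.conjugate_apply, K1.smul_apply, map_mul, Complex.conj_conj,
        mul_assoc, mul_left_comm c])
    (fun ψ φ χ => KU.ext fun x z => by
      change ∫ t, (φ + χ) t * atom ψ.conjugate x (-z) t =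
        (∫ t, φ t * atom ψ.conjugate x (-z) t) + ∫ t, χ t * atom ψ.conjugate x (-z) t
      rw [← integral_add (φ.integrable_mul _) (χ.integrable_mul _)]
      simp only [K1.add_apply, add_mul])
    (fun c ψ φ => KU.ext fun x z => by
      change ∫ t, (c • φ) t * atom ψ.conjugate x (-z) t =
        c * ∫ t, φ t * atom ψ.conjugate x (-z) t
      rw [← integral_const_mul]
      simp only [K1.smul_apply, mul_assoc])

lemma analysis_apply (γ φ : K1 n) (x : RSp n) (z : CSp n) :
    analysis n γ φ x z = stftFun φ γ.conjugate x (-z) := rfl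

lemma isBoundedBilin_analysis :
    IsBoundedBilin (K1.nuFamily n) (K1.nuFamily n) (KU.rhoFamily n)
      fun ψ φ => analysis n ψ φ := fun k => by
  have hC : 0 ≤ (1 + 2 * (n : ℝ)) ^ k * ∫ t : RSp n, decay t :=
    mul_nonneg (by positivity) (integral_nonneg decay_nonneg)
  exact ⟨k + expRate n k + (n + 1) + k, _, hC, fun ψ φ =>
    (rho_stftNeg_le ψ.conjugate φ k).trans (mul_le_mul_of_nonneg_left
      (mul_le_mul_of_nonneg_right (K1.nu_conjugate_le _ ψ) (apply_nonneg _ _)) hC)⟩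

lemma conj_cexpo_conjPt (z : CSp n) (t : RSp n) : conj (cexpo (conjPt z) t) = cexpo (-z) t := by
  rw [cexpo, cexpo, ← Complex.exp_conj]
  congr 1
  simp [cdot, conjPt, Complex.conj_ofNat]

lemma analysis_eq_conj_stftFun (ψ φ : K1 n) (x : RSp n) (z : CSp n) :
    analysis n ψ φ x z = conj (stftFun (fun t => conj (φ t)) ψ x (conjPt z)) := by
  simp only [analysis_apply, stftFun, ← integral_conj, map_mul, conj_cexpo_conjPt,
    Complex.conj_conj, K1.conjugate_apply]

open scoped FourierTransform


/-! ### Reconstruction -/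

lemma KU.integrable_cpt (Φ : KU n) (x η : RSp n) : Integrable fun ξ : RSp n => Φ x (cpt ξ η) := by
  obtain ⟨m, hm⟩ := exists_cpt_mem_tube η
  refine (integrable_decay.const_mul (2 ^ (m + (n + 1)) * rho n (m + (n + 1)) Φ)).mono'
    ((Φ.2.2.1 x).continuous.comp (ExpSTFT.continuous_cpt η)).aestronglyMeasurable
    (.of_forall fun ξ => ?_)
  have hdecay := one_add_norm_cpt_pow_le_decay_mul m ξ η
  have hΦ := Φ.exp_mul_pow_mul_norm_le x (KU.tube_mono (Nat.le_add_right m (n + 1)) (hm ξ))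
  have hd := decay_nonneg ξ
  calc ‖Φ x (cpt ξ η)‖
      ≤ decay ξ * (1 + ‖cpt ξ η‖) ^ (m + (n + 1)) * ‖Φ x (cpt ξ η)‖ :=
        le_mul_of_one_le_left (norm_nonneg _)
          ((one_le_pow₀ (le_add_of_nonneg_right (norm_nonneg _))).trans hdecay)
    _ ≤ decay ξ * (Real.exp ((m + (n + 1) : ℕ) * ‖x‖) * (1 + ‖cpt ξ η‖) ^ (m + (n + 1)) *
          ‖Φ x (cpt ξ η)‖) := by
        rw [mul_assoc]
        gcongr
        exact le_mul_of_one_le_left (by positivity) (Real.one_le_exp (by positivity))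
    _ ≤ decay ξ * (2 ^ (m + (n + 1)) * rho n (m + (n + 1)) Φ) := by gcongr
    _ = _ := mul_comm _ _

lemma cpt_zero_right_add (ξ η : RSp n) : cpt ξ η = cpt ξ 0 + cpt 0 η := by
  ext i; simp [cpt]

lemma neg_cpt (ξ η : RSp n) : -cpt ξ η = cpt (-ξ) (-η) := by
  ext i; simp [cpt]; ring

lemma cexpo_add (z w : CSp n) (t : RSp n) : cexpo (z + w) t = cexpo z t * cexpo w t := by
  have hcdot : cdot (z + w) t = cdot z t + cdot w t := by
    simp only [cdot, PiLp.add_apply, add_mul, Finset.sum_add_distrib]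
  rw [cexpo, hcdot, mul_add, Complex.exp_add, cexpo, cexpo]

lemma cexpo_mul_cexpo_neg (z : CSp n) (t : RSp n) : cexpo z t * cexpo (-z) t = 1 := by
  rw [← cexpo_add, add_neg_cancel]
  simp [cexpo, cdot]

lemma cexpo_cpt (ξ η t : RSp n) : cexpo (cpt ξ η) t =
    Complex.exp (((-2 * Real.pi * inner ℝ ξ t : ℝ) : ℂ) * Complex.I) * cexpo (cpt 0 η) t := by
  have hcdot : cdot (cpt ξ 0) t = (inner ℝ ξ t : ℝ) := by
    simp [cdot, cpt, PiLp.inner_apply, mul_comm]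
  rw [cpt_zero_right_add, cexpo_add, cexpo, hcdot]
  push_cast
  ring_nf

lemma analysis_cpt_eq_fourierInv (γ φ : K1 n) (x ξ η : RSp n) : analysis n γ φ x (cpt ξ η) =
    𝓕⁻ (fun t => φ t * atom γ.conjugate x (-cpt 0 η) t) ξ := by
  rw [analysis_apply, stftFun_eq_integral_mul_atom, Real.fourierInv_eq']
  refine integral_congr_ae (.of_forall fun t => ?_)
  have hexp : cexpo (-cpt ξ η) t =
      Complex.exp (((2 * Real.pi * inner ℝ t ξ : ℝ) : ℂ) * Complex.I) * cexpo (-cpt 0 η) t := by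
    rw [neg_cpt, cexpo_cpt, neg_cpt, neg_zero, inner_neg_left, mul_neg, real_inner_comm]
    simp only [neg_mul, neg_neg]
  simp only [atom_apply, hexp, smul_eq_mul]
  ring

lemma integral_analysis_mul_cexpo (γ φ : K1 n) (x t η : RSp n) :
    ∫ ξ, analysis n γ φ x (cpt ξ η) * cexpo (cpt ξ η) t = φ t * γ (t - x) := by
  set g : RSp n → ℂ := fun t => φ t * atom γ.conjugate x (-cpt 0 η) t with hg
  have hgc : Continuous g := φ.continuous.mul (atom γ.conjugate x (-cpt 0 η)).continuous
  have hgi : Integrable g := φ.integrable_mul _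
  have hinv : 𝓕⁻ g = fun ξ => analysis n γ φ x (cpt ξ η) :=
    funext fun ξ => (analysis_cpt_eq_fourierInv γ φ x ξ η).symm
  have hFi : Integrable (𝓕 g) := by
    have hF : 𝓕 g = fun ξ => 𝓕⁻ g (-ξ) := funext fun ξ => by
      rw [Real.fourierInv_eq_fourier_neg, neg_neg]
    rw [hF, hinv]
    exact ((analysis n γ φ).integrable_cpt x η).comp_neg
  have hfourier := congrFun (hgc.fourier_fourierInv_eq hgi hFi) t
  rw [hinv, Real.fourier_eq'] at hfourier
  calc ∫ ξ, analysis n γ φ x (cpt ξ η) * cexpo (cpt ξ η) t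
      = (∫ ξ, Complex.exp (((-2 * Real.pi * inner ℝ ξ t : ℝ) : ℂ) * Complex.I) •
          analysis n γ φ x (cpt ξ η)) * cexpo (cpt 0 η) t := by
        rw [← integral_mul_const]
        refine integral_congr_ae (.of_forall fun ξ => ?_)
        simp only [cexpo_cpt ξ η t, smul_eq_mul]
        ring
    _ = φ t * γ (t - x) * (cexpo (cpt 0 η) t * cexpo (-cpt 0 η) t) := by
        rw [hfourier, hg]
        simp only [atom_apply, K1.conjugate_apply, Complex.conj_conj]
        ring
    _ = φ t * γ (t - x) := by rw [cexpo_mul_cexpo_neg, mul_one]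

/-- Fourier inversion in the frequency variable leaves `φ(t) ∫ γ(t - x) conj(ψ(t - x)) dx`. -/
lemma synthesis_analysis (η : RSp n) (ψ γ φ : K1 n) :
    synthesis η ψ (analysis n γ φ) = ipL2 γ ψ • φ := by
  refine K1.ext fun t => ?_
  have hint := (integrableFamily_smul_atom η ψ (analysis n γ φ)).integrable_apply t
  have hinner (x : RSp n) :
      ∫ ξ, analysis n γ φ x (cpt ξ η) * (conj (ψ (t - x)) * cexpo (cpt ξ η) t) =
        φ t * (γ (t - x) * conj (ψ (t - x))) := by
    simp only [mul_left_comm _ (conj (ψ (t - x)))]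
    rw [integral_const_mul, integral_analysis_mul_cexpo]
    ring
  rw [Measure.volume_eq_prod] at hint
  calc synthesis η ψ (analysis n γ φ) t
      = ∫ x, ∫ ξ, analysis n γ φ x (cpt ξ η) * (conj (ψ (t - x)) * cexpo (cpt ξ η) t) := by
        rw [synthesis_apply, Measure.volume_eq_prod]
        exact integral_prod _ hint
    _ = φ t * ∫ x, γ (t - x) * conj (ψ (t - x)) := by
        simp only [hinner, integral_const_mul]
    _ = φ t * ipL2 γ ψ := by
        rw [integral_sub_left_eq_self (fun s => γ s * conj (ψ s)) volume t, ipL2]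
    _ = (ipL2 γ ψ • φ) t := mul_comm _ _

/-! ### The STFT and its adjoint -/

/-- The STFT `(f, ψ) ↦ V_ψ f` of distributions, as the transpose of synthesis on `ℝⁿ × ℝⁿ`. -/
def stft (n : ℕ) : K1Dual n →ₗ[ℂ] K1 n →ₗ⋆[ℂ] KUDual n :=
  transpose (synthesis 0) fun ψ => isBoundedBilin_synthesis 0 |>.continuous_right
    (KU.withSeminorms n) (K1.withSeminorms n) ψ

/-- The adjoint STFT `(F, ψ) ↦ V_ψ^* F`, as the transpose of analysis. -/
def adjointSTFT (n : ℕ) : KUDual n →ₗ[ℂ] K1 n →ₗ[ℂ] K1Dual n :=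
  transpose (analysis n) fun ψ => isBoundedBilin_analysis.continuous_right
    (K1.withSeminorms n) (KU.withSeminorms n) ψ

lemma isGivenBy_stft (f : K1Dual n) (ψ : K1 n) : IsGivenBy (stft n f ψ) (stftDist f ψ) :=
  fun Φ => ⟨integrable_stftDist_mul f ψ Φ 0, map_synthesis f ψ Φ 0⟩

lemma isAdjointSTFT_adjointSTFT (F : KUDual n) (ψ : K1 n) :
    IsAdjointSTFT F ψ (adjointSTFT n F ψ) :=
  fun φ => ⟨analysis n ψ φ, analysis_eq_conj_stftFun ψ φ, rfl⟩

lemma isHypocontinuous_stft : IsHypocontinuous fun f ψ => stft n f ψ :=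
  isHypocontinuous_transpose (KU.withSeminorms n) (K1.withSeminorms n) (K1.withSeminorms n)
    K1.nu_mono (isBoundedBilin_synthesis 0) _

lemma isHypocontinuous_adjointSTFT : IsHypocontinuous fun F ψ => adjointSTFT n F ψ :=
  isHypocontinuous_transpose (K1.withSeminorms n) (K1.withSeminorms n) (KU.withSeminorms n)
    KU.rho_mono isBoundedBilin_analysis _

end ExpSTFT

end

theorem mainTheorem4 (n : ℕ) :
    ∃ (V : K1Dual n →ₗ[ℂ] K1 n →ₗ⋆[ℂ] KUDual n) (Vs : KUDual n →ₗ[ℂ] K1 n →ₗ[ℂ] K1Dual n),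
      (∀ f ψ, IsGivenBy (V f ψ) (stftDist f ψ)) ∧
      (∀ F ψ, IsAdjointSTFT F ψ (Vs F ψ)) ∧
      IsHypocontinuous (fun f ψ => V f ψ) ∧
      IsHypocontinuous (fun F ψ => Vs F ψ) ∧
      ∀ ψ γ : K1 n, ψ ≠ 0 → ipL2 γ ψ ≠ 0 →
        (∀ f : K1Dual n, (ipL2 γ ψ)⁻¹ • Vs (V f ψ) γ = f) ∧
        ∀ (f : K1Dual n) (φ : K1 n) (η : RSp n),
          Integrable (fun p : RSp n × RSp n => stftDist f ψ p.1 (cpt p.2 η) *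
            stftFun φ (fun t => conj (γ t)) p.1 (-cpt p.2 η)) volume ∧
          f φ = (ipL2 γ ψ)⁻¹ * ∫ p : RSp n × RSp n, stftDist f ψ p.1 (cpt p.2 η) *
            stftFun φ (fun t => conj (γ t)) p.1 (-cpt p.2 η) := by
  refine ⟨stft n, adjointSTFT n, isGivenBy_stft, isAdjointSTFT_adjointSTFT, isHypocontinuous_stft,
    isHypocontinuous_adjointSTFT, fun ψ γ _ hγ => ?_⟩
  have reconstruction (η : RSp n) (f : K1Dual n) (φ : K1 n) :
      (ipL2 γ ψ)⁻¹ * f (synthesis η ψ (analysis n γ φ)) = f φ := by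
    rw [synthesis_analysis, map_smul, smul_eq_mul, inv_mul_cancel_left₀ hγ]
  refine ⟨fun f => ContinuousLinearMap.ext fun φ => reconstruction 0 f φ, fun f φ η =>
    ⟨integrable_stftDist_mul f ψ (analysis n γ φ) η, ?_⟩⟩
  rw [← reconstruction η f φ, map_synthesis]
  rfl
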